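/- Let $F_1\in\mathbb{C}^{N\times N}$, $F_2\in\mathbb{C}^{N\times N^2}$ and let $x:[0,\infty)\to\mathbb{C}^N$ solve $\dot x=F_1x+F_2x^{\otimes 2}$. Norms of vectors are Euclidean and norms of matrices are the induced operator norms. Suppose that: (i) $q^{(1)},\dots,q^{(M)}\in\mathbb{C}^N$ define linear conserved quantities $q^{(m)\dagger}x$ of the system, i.e. $q^{(m)\dagger}(F_1v+F_2v^{\otimes2})=0$ for every state $v\in\mathbb{C}^N$; (ii) $F_1=Q\Lambda Q^{-1}$ with $Q$ invertible and $\Lambda$ diagonal; the only eigenvalue of $F_1$ with non-negative real part is (possibly) $0$, and every $w$ with $w^\dagger F_1=0$ is a linear combination of the $q^{(m)}$; (iii) $\|Q^{-1}x(t)\|\le\|\tilde x_{\max}\|$ for all $t\ge0$, where $\|\tilde x_{\max}\|$ denotes a real constant. Let $\delta(F_1)=-\max\{\mathrm{Re}\,\lambda:\ \lambda\text{ an eigenvalue of }F_1,\ \mathrm{Re}\,\lambda\neq0\}$. For a rescaling $\gamma>0$, consider the rescaled system with state $\bar x=\gamma x$, linear coefficient $F_1$ and quadratic coefficient $\bar F_2=F_2/\gamma$.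 For $k\ge 1$ let $y=[y^{[1]},\dots,y^{[k]}]$ with $y^{[j]}\in(\mathbb{C}^N)^{\otimes j}$ be the solution on $[0,\infty)$ of its Carleman system truncated at level $k$: for $1\le j\le k$, $$\dot y^{[j]}=A_{j,j}\,y^{[j]}+A_{j,j+1}\,y^{[j+1]},\qquad y^{[j]}(0)=\bar x(0)^{\otimes j},\qquad y^{[k+1]}:=0,$$ where $A_{j,j}=\sum_{l=1}^{j}I^{\otimes(l-1)}\otimes F_1\otimes I^{\otimes(j-l)}$ and $A_{j,j+1}=\sum_{l=1}^{j}I^{\otimes(l-1)}\otimes\bar F_2\otimes I^{\otimes(j-l)}$. Let $\eta_j(t)=\bar x(t)^{\otimes j}-y^{[j]}(t)$ and $\eta=[\eta_1,\dots,\eta_k]$. (a) Put $R_\delta=\dfrac{2e\,\|\tilde x_{\max}\|\,\|Q^{-1}F_2Q^{\otimes2}\|}{\delta(F_1)}$ and $\gamma_0=\dfrac{e\,\|Q^{-1}F_2Q^{\otimes2}\|}{\delta(F_1)\|Q\|}$. Then for every rescaling $\gamma>0$ of the form $\gamma=p\gamma_0$ with $p\in(0,1]$, every $k\ge1$, $1\le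 j\le k$ and $t\ge0$, $$\|\eta_j(t)\|\le\frac{j}{2(k+1)}\,p^j\,R_\delta^{k+1},$$ and if $R_\delta<1$ then $\|\eta(t)\|\to0$ as $k\to\infty$, for every $t\ge0$. (b) Put $R'_\delta=\dfrac{4\,\|\tilde x_{\max}\|\,\|Q^{-1}F_2Q^{\otimes2}\|}{\delta(F_1)}$ and $\gamma_0'=\dfrac{16\,\|Q^{-1}F_2Q^{\otimes2}\|}{\delta(F_1)\|Q\|}$. Then for every rescaling $\gamma>0$ of the form $\gamma=p\gamma_0'$ with $p\in(0,1]$, every $k\ge1$ and $t\ge0$, $$\|\eta_1(t)\|\le p\,(R'_\delta)^{k+1},$$ and if $R'_\delta<1$ then $\|\eta_1(t)\|\to0$ as $k\to\infty$, for every $t\ge0$. Here $\gamma>0$ presupposes that $F_1$ has an eigenvalue with negative real part and that $F_2\ne0$, so that $\delta(F_1)$ and $R_\delta$ are well defined and $\gamma_0,\gamma_0'>0$. -/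

import Mathlib

open Set Filter Topology
open scoped Matrix Kronecker Matrix.Norms.L2Operator

noncomputable section

namespace CarlemanODE

/-- The state space `ℂ^N` with its Euclidean norm. -/
abbrev Vec (N : ℕ) : Type := EuclideanSpace ℂ (Fin N)

/-- The `j`-copy space `(ℂ^N)^{⊗ j}`, a tensor being given by its `N ^ j` coordinates,
with its Euclidean norm. -/
abbrev Tensor (N j : ℕ) : Type := EuclideanSpace ℂ (Fin j → Fin N)

/-- The tensor power `x^{⊗ j}`. -/
def tensorPow {N : ℕ} (j : ℕ) (x : Vec N) : Tensor N j :=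
  WithLp.toLp 2 fun a => ∏ l, x (a l)

/-- The vector `v ⊗ v` on which the quadratic coefficient acts. -/
def tensorSq {N : ℕ} (v : Fin N → ℂ) : Fin N × Fin N → ℂ :=
  fun a => v a.1 * v a.2

/-- The right-hand side `F₁ x + F₂ (x ⊗ x)` of the quadratic ODE. -/
def quadField {N : ℕ} (F₁ : Matrix (Fin N) (Fin N) ℂ) (F₂ : Matrix (Fin N) (Fin N × Fin N) ℂ)
    (x : Fin N → ℂ) : Fin N → ℂ :=
  F₁ *ᵥ x + F₂ *ᵥ tensorSq x

/-- `x` solves `ẋ = F₁ x + F₂ x^{⊗ 2}` on `[0, ∞)` (one-sided derivative at `0`). -/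
def IsQuadSolution {N : ℕ} (F₁ : Matrix (Fin N) (Fin N) ℂ)
    (F₂ : Matrix (Fin N) (Fin N × Fin N) ℂ) (x : ℝ → Vec N) : Prop :=
  ∀ t : ℝ, 0 ≤ t → HasDerivWithinAt x (WithLp.toLp 2 (quadField F₁ F₂ (x t))) (Ici 0) t

/-- The linear functional `x ↦ q† x` is a conserved quantity of the system: its rate of change
`q† (F₁ v + F₂ v^{⊗ 2})` under the dynamics vanishes at every state `v`. -/
def IsLinearConserved {N : ℕ} (F₁ : Matrix (Fin N) (Fin N) ℂ)
    (F₂ : Matrix (Fin N) (Fin N × Fin N) ℂ) (q : Fin N → ℂ) : Prop :=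
  ∀ v : Fin N → ℂ, star q ⬝ᵥ quadField F₁ F₂ v = 0

/-- The real spectral gap: minus the largest nonzero real part of an eigenvalue. -/
def realSpectralGap {N : ℕ} (F₁ : Matrix (Fin N) (Fin N) ℂ) : ℝ :=
  -sSup {r : ℝ | r ≠ 0 ∧ ∃ μ ∈ spectrum ℂ F₁, μ.re = r}

/-- The block `A_{j,j} = F₁ ⊗ I^{⊗ (j-1)} + shifts`: the sum over `l` of the operators that act as
`F₁` on the `l`-th factor and as the identity on the others. -/
def linBlock {N : ℕ} (F₁ : Matrix (Fin N) (Fin N) ℂ) (j : ℕ) :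
    Matrix (Fin j → Fin N) (Fin j → Fin N) ℂ :=
  Matrix.of fun a b =>
    ∑ l, F₁ (a l) (b l) * ∏ m ∈ Finset.univ.erase l, (1 : Matrix (Fin N) (Fin N) ℂ) (a m) (b m)

/-- The block `A_{j,j+1} = F₂ ⊗ I^{⊗ (j-1)} + shifts`: the sum over `l` of the operators that send
the factors `l, l + 1` to the factor `l` by `F₂` and act as the identity on the others (the factors
beyond `l + 1` move down by one place). -/
def quadBlock {N : ℕ} (F₂ : Matrix (Fin N) (Fin N × Fin N) ℂ) (j : ℕ) :
    Matrix (Fin j → Fin N) (Fin (j + 1) → Fin N) ℂ :=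
  Matrix.of fun a b =>
    ∑ l, F₂ (a l) (b l.castSucc, b l.succ) *
      ∏ m ∈ Finset.univ.erase l,
        (1 : Matrix (Fin N) (Fin N) ℂ) (a m) (if m < l then b m.castSucc else b m.succ)

/-- Coordinates of `⊕_{j=1}^k (ℂ^N)^{⊗ j}`. The element `j : Fin k` stands for block `j + 1`. -/
abbrev CarlemanIndex (N k : ℕ) : Type := Σ j : Fin k, (Fin (j.val + 1) → Fin N)

/-- The space `⊕_{j=1}^k (ℂ^N)^{⊗ j}` with its Euclidean norm. -/
abbrev CarlemanSpace (N k : ℕ) : Type := EuclideanSpace ℂ (CarlemanIndex N k)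

/-- The Carleman matrix truncated at level `k` (no driving): blocks `A_{j,j}` on the diagonal,
blocks `A_{j,j+1}` above it, and zeros elsewhere. -/
def carlemanMatrix {N : ℕ} (F₁ : Matrix (Fin N) (Fin N) ℂ)
    (F₂ : Matrix (Fin N) (Fin N × Fin N) ℂ) (k : ℕ) :
    Matrix (CarlemanIndex N k) (CarlemanIndex N k) ℂ :=
  Matrix.of fun r s =>
    if h : r.1.val = s.1.val then
      linBlock F₁ (r.1.val + 1) r.2 fun l => s.2 (Fin.cast (by rw [h]) l)
    else if h : r.1.val + 1 = s.1.val then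
      quadBlock F₂ (r.1.val + 1) r.2 fun l => s.2 (Fin.cast (by rw [h]) l)
    else 0

/-- The vector `[x, x^{⊗ 2}, …, x^{⊗ k}]`. -/
def carlemanLift {N : ℕ} (k : ℕ) (x : Vec N) : CarlemanSpace N k :=
  WithLp.toLp 2 fun r => tensorPow (r.1.val + 1) x r.2

/-- The block of index `j : Fin k`, that is `y^{[j+1]}`. -/
def carlemanBlock {N k : ℕ} (j : Fin k) (y : CarlemanSpace N k) : Tensor N (j.val + 1) :=
  WithLp.toLp 2 fun a => y ⟨j, a⟩

/-- `y` solves the Carleman system `ẏ = A y`, `y(0) = [x₀, x₀^{⊗ 2}, …, x₀^{⊗ k}]`, truncated at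
level `k`, on `[0, ∞)`. -/
def IsCarlemanSolution {N : ℕ} (F₁ : Matrix (Fin N) (Fin N) ℂ)
    (F₂ : Matrix (Fin N) (Fin N × Fin N) ℂ) (k : ℕ) (x₀ : Vec N) (y : ℝ → CarlemanSpace N k) :
    Prop :=
  y 0 = carlemanLift k x₀ ∧
    ∀ t : ℝ, 0 ≤ t →
      HasDerivWithinAt y (WithLp.toLp 2 (carlemanMatrix F₁ F₂ k *ᵥ y t)) (Ici 0) t

/-- The block of index `j : Fin k` of the Carleman error vector, that is
`η_{j+1}(t) = x(t)^{⊗ (j+1)} - y^{[j+1]}(t)`. -/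
def blockError {N k : ℕ} (x : ℝ → Vec N) (y : ℝ → CarlemanSpace N k) (j : Fin k) (t : ℝ) :
    Tensor N (j.val + 1) :=
  tensorPow (j.val + 1) (x t) - carlemanBlock j (y t)

/-- The Carleman error vector `η(t) = [η_1(t), …, η_k(t)]`. -/
def carlemanError {N k : ℕ} (x : ℝ → Vec N) (y : ℝ → CarlemanSpace N k) (t : ℝ) :
    CarlemanSpace N k :=
  WithLp.toLp 2 fun r => blockError x y r.1 t r.2

/-- The transformed quadratic coefficient `Q⁻¹ F₂ Q^{⊗ 2}`. -/
def conjQuad {N : ℕ} (Q : Matrix (Fin N) (Fin N) ℂ) (F₂ : Matrix (Fin N) (Fin N × Fin N) ℂ) :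
    Matrix (Fin N) (Fin N × Fin N) ℂ :=
  Q⁻¹ * F₂ * (Q ⊗ₖ Q)

end CarlemanODE

end

/-!
In the coordinates given by `Q⁻¹`, the linear part of the hierarchy satisfied by the Carleman errors
`η_j` is diagonal: the coordinate of `η_j` at a multi-index `a` has the rate `∑ l, Λ (a l)`, and it
is driven by the contraction of `η_{j+1}` with `Q⁻¹ F₂ Q^{⊗ 2}` (`norm_blockError_le` transports the
hierarchy and the estimate between the two coordinate systems). At level `k + 1` the error is replaced
by the full tensor power of the transformed solution, which is bounded by assumption.

The difficulty is that a mode with `Λ i = 0` does not decay. Call a slot `l` of `a` decaying if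
`Λ (a l) ≠ 0`, and group multi-indices into classes according to their decaying slots.

* The row of `Q⁻¹` at a mode with `Λ i = 0` is a left null vector of `F₁`, hence a combination of
  conserved quantities, so that this row of `Q⁻¹ F₂ Q^{⊗ 2}` annihilates every `v ⊗ v` and therefore
  every symmetric tensor (`conjQuad_antisymm`, `slot_eq_zero_of_antisymm`).
* The errors are symmetric tensors, although `F₂` need not be symmetric
  (`level_factorsThrough`).

Thus a contraction contributes only if its output slot is decaying. On a class with `n > 0` decaying
slots the decay rate is at least `n δ`, while only `n` of the contractions contribute: the factor `n`
cancels (`level_step`), and a class without decaying slots carries no error at all. A contraction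
leaves two slots of the upper level free, that is four classes, each with the same bound on its squared
norm, so each step down costs a factor `2 ‖Q⁻¹ F₂ Q^{⊗ 2}‖ / δ` in norm. Summing over the classes
gives `hierarchy_bound`, and both parts of the theorem follow from it by comparing constants.
-/

namespace CarlemanODE

/-! ### Tensors as functions of multi-indices -/

/-- The multi-index obtained from `a` by replacing its `l`-th entry by the two entries `b, c`. -/
def splitSlot {α : Type*} {j : ℕ} (l : Fin j) (b c : α) (a : Fin j → α) : Fin (j + 1) → α :=
  l.castSucc.insertNth (α := fun _ => α) b (Function.update a l c)

/-- The action of the block `A_{j,j+1}` on coordinates: the sum over `l` of the terms in which the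
slots `l, l + 1` of `u` are contracted with `F`. -/
noncomputable def quadAct {N : ℕ} (F : Matrix (Fin N) (Fin N × Fin N) ℂ) {j : ℕ}
    (u : (Fin (j + 1) → Fin N) → ℂ) (a : Fin j → Fin N) : ℂ :=
  ∑ l, ∑ b, ∑ c, F (a l) (b, c) * u (splitSlot l b c a)

theorem splitSlot_castSucc {α : Type*} {j : ℕ} (l : Fin j) (b c : α) (a : Fin j → α) :
    splitSlot l b c a l.castSucc = b := by
  simp [splitSlot]

theorem splitSlot_succAbove {α : Type*} {j : ℕ} (l : Fin j) (b c : α) (a : Fin j → α) (m : Fin j) :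
    splitSlot l b c a (l.castSucc.succAbove m) = Function.update a l c m := by
  simp [splitSlot]

theorem splitSlot_insertNth {α : Type*} {m : ℕ} (l : Fin (m + 1)) (b c i : α) (r : Fin m → α) :
    splitSlot l b c (l.insertNth (α := fun _ => α) i r) =
      l.castSucc.insertNth (α := fun _ => α) b (l.insertNth (α := fun _ => α) c r) := by
  unfold splitSlot
  congr 1
  simp

theorem comp_insertNth {α β : Type*} (φ : α → β) {m : ℕ} (l : Fin (m + 1)) (i : α)
    (r : Fin m → α) :
    φ ∘ (l.insertNth (α := fun _ => α) i r) = l.insertNth (α := fun _ => β) (φ i) (φ ∘ r) := by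
  funext x
  refine l.succAboveCases ?_ (fun y => ?_) x <;> simp

theorem sum_insertNth {α M : Type*} [Fintype α] [AddCommMonoid M] {m : ℕ} (l : Fin (m + 1))
    (X : (Fin (m + 1) → α) → M) :
    ∑ a, X a = ∑ r : Fin m → α, ∑ i : α, X (l.insertNth (α := fun _ => α) i r) := by
  rw [← (Fin.insertNthEquiv (fun _ => α) l).sum_comp, Fintype.sum_prod_type_right]
  rfl

theorem prod_splitSlot {α M : Type*} [CommMonoid M] {j : ℕ} (l : Fin j) (b c : α) (a : Fin j → α)
    (g : Fin (j + 1) → α → M) :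
    ∏ m, g m (splitSlot l b c a m) = g l.castSucc b * (g (l.castSucc.succAbove l) c *
      ∏ m ∈ Finset.univ.erase l, g (l.castSucc.succAbove m) (a m)) := by
  rw [Fin.prod_univ_succAbove _ l.castSucc, splitSlot_castSucc]
  simp only [splitSlot_succAbove]
  rw [← Finset.mul_prod_erase _ _ (Finset.mem_univ l), Function.update_self]
  congr 2
  refine Finset.prod_congr rfl fun m hm => ?_
  rw [Function.update_of_ne (Finset.ne_of_mem_erase hm)]

theorem quadBlock_apply {N : ℕ} (F : Matrix (Fin N) (Fin N × Fin N) ℂ) (j : ℕ)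
    (a : Fin j → Fin N) (d : Fin (j + 1) → Fin N) :
    quadBlock F j a d = ∑ l, F (a l) (d l.castSucc, d (l.castSucc.succAbove l)) *
      ∏ m ∈ Finset.univ.erase l,
        (1 : Matrix (Fin N) (Fin N) ℂ) (a m) (d (l.castSucc.succAbove m)) := by
  have h : ∀ l m : Fin j,
      d (l.castSucc.succAbove m) = if m < l then d m.castSucc else d m.succ := by
    intro l m
    simp only [Fin.succAbove, Fin.castSucc_lt_castSucc_iff]
    split_ifs <;> rfl
  simp only [quadBlock, Matrix.of_apply]
  refine Finset.sum_congr rfl fun l _ => ?_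
  rw [h l l, if_neg (lt_irrefl l)]
  congr 1
  exact Finset.prod_congr rfl fun m _ => by rw [h]

theorem quadBlock_mulVec {N : ℕ} (F : Matrix (Fin N) (Fin N × Fin N) ℂ) (j : ℕ)
    (u : (Fin (j + 1) → Fin N) → ℂ) : quadBlock F j *ᵥ u = quadAct F u := by
  funext a
  simp only [Matrix.mulVec, dotProduct, quadBlock_apply, quadAct, Finset.sum_mul]
  rw [Finset.sum_comm]
  refine Finset.sum_congr rfl fun l _ => ?_
  rw [sum_insertNth l.castSucc, Finset.sum_comm]
  refine Finset.sum_congr rfl fun b _ => ?_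
  simp only [Fin.insertNth_apply_same, Fin.insertNth_apply_succAbove]
  symm
  -- only the indices that agree with `a` away from `l` contribute
  refine Finset.sum_of_injOn (fun c => Function.update a l c)
    ((Function.update_injective a l).injOn) (by simp) ?_ ?_
  · intro r _ hr
    have : ∃ m, m ≠ l ∧ a m ≠ r m := by
      by_contra! h
      refine hr ⟨r l, by simp, ?_⟩
      funext m
      by_cases hm : m = l
      · subst hm; simp
      · simp [hm, h m hm]
    obtain ⟨m, hm, h⟩ := this
    rw [Finset.prod_eq_zero (Finset.mem_erase.2 ⟨hm, Finset.mem_univ m⟩), mul_zero, zero_mul]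
    rw [Fin.insertNth_apply_succAbove]
    exact Matrix.one_apply_ne h
  · intro c _
    have h1 : ∏ m ∈ Finset.univ.erase l,
        (1 : Matrix (Fin N) (Fin N) ℂ) (a m) (l.castSucc.insertNth (α := fun _ => Fin N) b
          (Function.update a l c) (l.castSucc.succAbove m)) = 1 := by
      refine Finset.prod_eq_one fun m hm => ?_
      rw [Fin.insertNth_apply_succAbove, Function.update_of_ne (Finset.ne_of_mem_erase hm),
        Matrix.one_apply_eq]
    rw [h1, Function.update_self, mul_one]
    rfl

/-! ### Symmetric tensors -/

/-- The multiset of the entries of a multi-index. A tensor `u` is symmetric when its coordinates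
depend on this multiset only, that is when `u.FactorsThrough entries`. -/
def entries {α : Type*} {j : ℕ} (a : Fin j → α) : Multiset α :=
  Finset.univ.val.map a

theorem entries_splitSlot {α : Type*} [DecidableEq α] {j : ℕ} (l : Fin j) (b c : α)
    (a : Fin j → α) : entries (splitSlot l b c a) = b ::ₘ c ::ₘ (entries a).erase (a l) := by
  have h1 : entries (splitSlot l b c a) = b ::ₘ entries (Function.update a l c) := by
    unfold entries
    rw [Fin.univ_succAbove _ l.castSucc, Finset.cons_val, Multiset.map_cons, splitSlot_castSucc,
      Finset.map_val, Multiset.map_map]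
    congr 1
    refine Multiset.map_congr rfl fun m _ => ?_
    exact splitSlot_succAbove l b c a m
  have h2 : ∀ a' : Fin j → α,
      entries a' = a' l ::ₘ (Finset.univ.erase l).val.map a' := by
    intro a'
    unfold entries
    rw [← Multiset.map_cons, Finset.erase_val, Multiset.cons_erase (Finset.mem_univ_val l)]
  rw [h1, h2 (Function.update a l c), h2 a, Multiset.erase_cons_head, Function.update_self]
  congr 2
  refine Multiset.map_congr rfl fun m hm => ?_
  rw [Function.update_of_ne (Finset.ne_of_mem_erase (Finset.mem_def.2 hm))]

theorem quadAct_factorsThrough {N : ℕ} (F : Matrix (Fin N) (Fin N × Fin N) ℂ) {j : ℕ}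
    {u : (Fin (j + 1) → Fin N) → ℂ} (hu : u.FactorsThrough entries) :
    (quadAct F u).FactorsThrough entries := by
  classical
  obtain ⟨g, rfl⟩ := (Function.factorsThrough_iff u).1 hu
  have key : ∀ a : Fin j → Fin N, quadAct F (g ∘ entries) a = ((entries a).map fun s =>
      ∑ b, ∑ c, F s (b, c) * g (b ::ₘ c ::ₘ (entries a).erase s)).sum := by
    intro a
    conv_rhs => enter [1, 2]; rw [entries]
    rw [Multiset.map_map]
    simp only [quadAct, Function.comp, entries_splitSlot]
    rfl
  intro a a' h
  rw [key, key, h]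

theorem prod_factorsThrough {α M : Type*} [CommMonoid M] (g : α → M) (j : ℕ) :
    (fun a : Fin j → α => ∏ l, g (a l)).FactorsThrough entries := by
  have key : ∀ a : Fin j → α, ∏ l, g (a l) = ((entries a).map g).prod := by
    intro a
    rw [entries, Multiset.map_map]
    rfl
  intro a a' h
  simp only [key, h]

theorem sum_factorsThrough {α M : Type*} [AddCommMonoid M] (g : α → M) (j : ℕ) :
    (fun a : Fin j → α => ∑ l, g (a l)).FactorsThrough entries := by
  have key : ∀ a : Fin j → α, ∑ l, g (a l) = ((entries a).map g).sum := by
    intro a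
    rw [entries, Multiset.map_map]
    rfl
  intro a a' h
  simp only [key, h]

/-- A row of `F` that is antisymmetric in its two inputs annihilates symmetric tensors. -/
theorem slot_eq_zero_of_antisymm {N : ℕ} (F : Matrix (Fin N) (Fin N × Fin N) ℂ) {j : ℕ}
    {u : (Fin (j + 1) → Fin N) → ℂ} (hu : u.FactorsThrough entries) (a : Fin j → Fin N) (l : Fin j)
    (hF : ∀ b c, F (a l) (b, c) + F (a l) (c, b) = 0) :
    ∑ b, ∑ c, F (a l) (b, c) * u (splitSlot l b c a) = 0 := by
  have h1 : ∑ b, ∑ c, F (a l) (b, c) * u (splitSlot l b c a) =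
      -∑ b, ∑ c, F (a l) (b, c) * u (splitSlot l b c a) := by
    conv_lhs => rw [Finset.sum_comm]
    rw [← Finset.sum_neg_distrib]
    refine Finset.sum_congr rfl fun b _ => ?_
    rw [← Finset.sum_neg_distrib]
    refine Finset.sum_congr rfl fun c _ => ?_
    have h2 : u (splitSlot l c b a) = u (splitSlot l b c a) := by
      refine hu ?_
      rw [entries_splitSlot, entries_splitSlot, Multiset.cons_swap]
    rw [h2, eq_neg_of_add_eq_zero_right (hF b c), neg_mul]
  exact self_eq_neg.1 h1

/-! ### Norms of tensors with prescribed slots -/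

theorem sum_norm_mulVec_sq_le {m n : Type*} [Fintype m] [Fintype n] [DecidableEq n]
    (A : Matrix m n ℂ) (v : n → ℂ) :
    ∑ i, ‖∑ i', A i i' * v i'‖ ^ 2 ≤ ‖A‖ ^ 2 * ∑ i', ‖v i'‖ ^ 2 := by
  have h := Matrix.l2_opNorm_mulVec A (WithLp.toLp 2 v)
  have h2 := pow_le_pow_left₀ (norm_nonneg _) h 2
  rw [mul_pow, EuclideanSpace.norm_sq_eq, EuclideanSpace.norm_sq_eq] at h2
  exact h2

theorem sum_slot_sq_le {α : Type*} {N : ℕ} [DecidableEq α] (φ : Fin N → α)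
    (F : Matrix (Fin N) (Fin N × Fin N) ℂ) {m : ℕ} (u : (Fin (m + 2) → Fin N) → ℂ)
    (l : Fin (m + 1)) (ρ : Fin (m + 1) → α) :
    ∑ a with φ ∘ a = ρ, ‖∑ b, ∑ c, F (a l) (b, c) * u (splitSlot l b c a)‖ ^ 2 ≤
      ‖F‖ ^ 2 * ∑ r with φ ∘ r = l.removeNth ρ, ∑ b, ∑ c,
        ‖u (l.castSucc.insertNth (α := fun _ => Fin N) b
          (l.insertNth (α := fun _ => Fin N) c r))‖ ^ 2 := by
  rw [Finset.sum_filter, sum_insertNth l, Finset.mul_sum, Finset.sum_filter]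
  refine Finset.sum_le_sum fun r _ => ?_
  by_cases hr : φ ∘ r = l.removeNth ρ
  · rw [if_pos hr]
    have h := sum_norm_mulVec_sq_le F fun bc : Fin N × Fin N =>
      u (l.castSucc.insertNth (α := fun _ => Fin N) bc.1
          (l.insertNth (α := fun _ => Fin N) bc.2 r))
    simp only [Fintype.sum_prod_type] at h
    refine le_trans (Finset.sum_le_sum fun i _ => ?_) h
    simp only [splitSlot_insertNth, Fin.insertNth_apply_same]
    split_ifs
    · exact le_rfl
    · positivity
  · rw [if_neg hr]
    refine le_of_eq (Finset.sum_eq_zero fun i _ => if_neg fun h => hr ?_)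
    rw [← h, comp_insertNth, Fin.removeNth_insertNth]

theorem sum_insertNth_insertNth_le {α : Type*} [Fintype α] {m : ℕ} (l : Fin (m + 1))
    (p : (Fin m → α) → Prop) [DecidablePred p] {X : (Fin (m + 2) → α) → ℝ} (hX : ∀ a, 0 ≤ X a) :
    ∑ r with p r, ∑ b, ∑ c, X (l.castSucc.insertNth (α := fun _ => α) b
          (l.insertNth (α := fun _ => α) c r)) ≤ ∑ a, X a := by
  have h : ∑ a, X a = ∑ r, ∑ b, ∑ c, X (l.castSucc.insertNth (α := fun _ => α) b
          (l.insertNth (α := fun _ => α) c r)) := by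
    rw [sum_insertNth l.castSucc, sum_insertNth l]
    exact Finset.sum_congr rfl fun r _ => Finset.sum_comm
  rw [h]
  exact Finset.sum_le_univ_sum_of_nonneg fun r =>
    Finset.sum_nonneg fun b _ => Finset.sum_nonneg fun c _ => hX _

/-- Leaving two slots free costs a factor `2 ^ 2` when each slot has one of two types. -/
theorem sum_free_slots_le {N : ℕ} (φ : Fin N → Bool) {m : ℕ} (u : (Fin (m + 2) → Fin N) → ℂ)
    (l : Fin (m + 1)) {C : ℝ} (hu : ∀ ρ, ∑ a with φ ∘ a = ρ, ‖u a‖ ^ 2 ≤ C) (ρ : Fin m → Bool) :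
    ∑ r with φ ∘ r = ρ, ∑ b, ∑ c,
        ‖u (l.castSucc.insertNth (α := fun _ => Fin N) b
          (l.insertNth (α := fun _ => Fin N) c r))‖ ^ 2 ≤ 4 * C := by
  have h1 : ∀ β β' : Bool, ∑ r, ∑ b, ∑ c,
      (if φ ∘ (l.castSucc.insertNth (α := fun _ => Fin N) b
          (l.insertNth (α := fun _ => Fin N) c r)) =
          l.castSucc.insertNth (α := fun _ => Bool) β (l.insertNth (α := fun _ => Bool) β' ρ) then
        ‖u (l.castSucc.insertNth (α := fun _ => Fin N) b
          (l.insertNth (α := fun _ => Fin N) c r))‖ ^ 2 else 0) ≤ C := by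
    intro β β'
    refine le_trans (le_of_eq ?_)
      (hu (l.castSucc.insertNth (α := fun _ => Bool) β (l.insertNth (α := fun _ => Bool) β' ρ)))
    rw [Finset.sum_filter, sum_insertNth l.castSucc, sum_insertNth l]
    exact Finset.sum_congr rfl fun r _ => Finset.sum_comm
  have h2 := Finset.sum_le_sum fun β (_ : β ∈ (Finset.univ : Finset Bool)) =>
    Finset.sum_le_sum fun β' (_ : β' ∈ (Finset.univ : Finset Bool)) => h1 β β'
  refine le_trans ?_ (h2.trans (le_of_eq ?_))
  · have h3 : ∀ X : Bool → Bool → (Fin m → Fin N) → Fin N → Fin N → ℝ,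
        ∑ β, ∑ β', ∑ r, ∑ b, ∑ c, X β β' r b c = ∑ r, ∑ b, ∑ c, ∑ β, ∑ β', X β β' r b c := by
      intro X
      simp only [Fintype.sum_bool, Finset.sum_add_distrib]
    rw [h3, Finset.sum_filter]
    refine Finset.sum_le_sum fun r _ => ?_
    split_ifs with hr
    · refine Finset.sum_le_sum fun b _ => Finset.sum_le_sum fun c _ => ?_
      refine le_trans ?_ (Finset.single_le_sum (f := fun β => ∑ β' : Bool, _)
        (fun β _ => Finset.sum_nonneg fun β' _ => ?_) (Finset.mem_univ (φ b)))
      · refine le_trans ?_ (Finset.single_le_sum (fun β' _ => ?_) (Finset.mem_univ (φ c)))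
        · rw [if_pos]
          rw [comp_insertNth, comp_insertNth, hr]
        · split_ifs <;> positivity
      · split_ifs <;> positivity
    · exact Finset.sum_nonneg fun b _ => Finset.sum_nonneg fun c _ => Finset.sum_nonneg fun β _ =>
        Finset.sum_nonneg fun β' _ => by split_ifs <;> positivity
  · simp
    ring

/-! ### Forced linear equations on a half-line -/

theorem eq_zero_of_hasDerivWithinAt_mul {u : ℝ → ℂ} {μ : ℂ} (h0 : u 0 = 0)
    (hu : ∀ t : ℝ, 0 ≤ t → HasDerivWithinAt u (μ * u t) (Ici 0) t) {t : ℝ} (ht : 0 ≤ t) :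
    u t = 0 := by
  have h := ODE_solution_unique (v := fun _ z => μ * z) (K := ‖μ‖₊) (f := u) (g := fun _ => 0)
    (a := 0) (b := t)
    (fun _ => LipschitzWith.of_dist_le_mul fun z w => by
      rw [dist_eq_norm, ← mul_sub, norm_mul, dist_eq_norm]; rfl)
    (fun s hs => (hu s hs.1).continuousWithinAt.mono Icc_subset_Ici_self)
    (fun s hs => (hu s hs.1).mono (Ici_subset_Ici.2 hs.1))
    continuousOn_const
    (fun s _ => by simpa using hasDerivWithinAt_const s (Ici s) (0 : ℂ)) h0
  exact h ⟨ht, le_rfl⟩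

/-- A diagonal linear system with decay rate `c`, started at `0` and driven by a forcing of norm at
most `G`, stays in the ball of radius `G / c`. -/
theorem sum_norm_sq_le_of_decay {ι : Type*} (s : Finset ι) {v g : ℝ → ι → ℂ} {μ : ι → ℂ} {c G : ℝ}
    (hc : 0 < c) (hμ : ∀ a ∈ s, (μ a).re ≤ -c) (h0 : ∀ a ∈ s, v 0 a = 0)
    (hv : ∀ t : ℝ, 0 ≤ t → ∀ a ∈ s,
      HasDerivWithinAt (fun τ => v τ a) (μ a * v t a + g t a) (Ici 0) t)
    (hg : ∀ t : ℝ, 0 ≤ t → ∑ a ∈ s, ‖g t a‖ ^ 2 ≤ G ^ 2) {t : ℝ} (ht : 0 ≤ t) :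
    ∑ a ∈ s, ‖v t a‖ ^ 2 ≤ (G / c) ^ 2 := by
  have hd : ∀ τ : ℝ, 0 ≤ τ → HasDerivWithinAt (fun τ => ∑ a ∈ s, ‖v τ a‖ ^ 2)
      (∑ a ∈ s, 2 * inner ℝ (v τ a) (μ a * v τ a + g τ a)) (Ici 0) τ := fun τ hτ =>
    HasDerivWithinAt.fun_sum fun a ha => (hv τ hτ a ha).norm_sq
  have hle : ∀ τ : ℝ, 0 ≤ τ → ∑ a ∈ s, 2 * inner ℝ (v τ a) (μ a * v τ a + g τ a) ≤
      -c * ∑ a ∈ s, ‖v τ a‖ ^ 2 + G ^ 2 / c := by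
    intro τ hτ
    have h1 : ∀ a ∈ s, 2 * inner ℝ (v τ a) (μ a * v τ a + g τ a) ≤
        -c * ‖v τ a‖ ^ 2 + ‖g τ a‖ ^ 2 / c := by
      intro a ha
      have h2 : inner ℝ (v τ a) (μ a * v τ a) = (μ a).re * ‖v τ a‖ ^ 2 := by
        rw [Complex.inner, mul_assoc, Complex.mul_conj, Complex.normSq_eq_norm_sq,
          Complex.re_mul_ofReal]
      have h3 : inner ℝ (v τ a) (g τ a) ≤ ‖v τ a‖ * ‖g τ a‖ := real_inner_le_norm _ _
      have h4 := mul_le_mul_of_nonneg_right (hμ a ha) (sq_nonneg ‖v τ a‖)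
      have h5 : 2 * (‖v τ a‖ * ‖g τ a‖) ≤ c * ‖v τ a‖ ^ 2 + ‖g τ a‖ ^ 2 / c := by
        have h6 : 0 ≤ (c * ‖v τ a‖ - ‖g τ a‖) ^ 2 / c := by positivity
        have h7 : (c * ‖v τ a‖ - ‖g τ a‖) ^ 2 / c =
            c * ‖v τ a‖ ^ 2 - 2 * (‖v τ a‖ * ‖g τ a‖) + ‖g τ a‖ ^ 2 / c := by
          field_simp
          ring
        linarith
      rw [inner_add_right, h2]
      linarith
    refine (Finset.sum_le_sum h1).trans ?_
    rw [Finset.sum_add_distrib, ← Finset.mul_sum, ← Finset.sum_div]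
    gcongr
    exact hg τ hτ
  -- the derivative is negative at any level above `(G / c) ^ 2`, so such a level is never crossed
  refine le_of_forall_pos_le_add fun ε hε => ?_
  refine image_le_of_deriv_right_lt_deriv_boundary' (a := 0) (b := t)
    (fun τ hτ => (hd τ hτ.1).continuousWithinAt.mono Icc_subset_Ici_self)
    (fun τ hτ => (hd τ hτ.1).mono (Ici_subset_Ici.2 hτ.1))
    (B := fun _ => (G / c) ^ 2 + ε) (B' := fun _ => 0) ?_ continuousOn_const
    (fun τ _ => hasDerivWithinAt_const _ _ _) ?_ ⟨ht, le_rfl⟩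
  · have : ∑ a ∈ s, ‖v 0 a‖ ^ 2 = 0 := Finset.sum_eq_zero fun a ha => by simp [h0 a ha]
    rw [this]
    positivity
  · intro τ hτ h
    refine (hle τ hτ.1).trans_lt ?_
    rw [h]
    have : -c * ((G / c) ^ 2 + ε) + G ^ 2 / c = -(c * ε) := by
      field_simp
      ring
    rw [this]
    have := mul_pos hc hε
    linarith

/-! ### The diagonalized error hierarchy -/

/-- One step down the hierarchy: on a class of multi-indices with `n` decaying slots, the decay rate
is `n * δ`, and only the `n` contractions into a decaying slot contribute to the forcing. The
number `n` cancels. -/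
theorem level_step {N m : ℕ} {Λ : Fin N → ℂ} {F : Matrix (Fin N) (Fin N × Fin N) ℂ} {δ K : ℝ}
    (hδ : 0 < δ)
    (hre : ∀ i, Λ i ≠ 0 → (Λ i).re ≤ -δ)
    (hF : ∀ i, Λ i = 0 → ∀ b c, F i (b, c) + F i (c, b) = 0)
    {u : ℝ → (Fin (m + 1) → Fin N) → ℂ} {w : ℝ → (Fin (m + 2) → Fin N) → ℂ}
    (h0 : ∀ a, u 0 a = 0)
    (hu : ∀ t : ℝ, 0 ≤ t → ∀ a, HasDerivWithinAt (fun s => u s a)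
      ((∑ l, Λ (a l)) * u t a + quadAct F (w t) a) (Ici 0) t)
    (hw : ∀ t : ℝ, 0 ≤ t → (w t).FactorsThrough entries)
    (hwK : ∀ t : ℝ, 0 ≤ t → ∀ (l : Fin (m + 1)) (ρ : Fin m → Bool),
      ∑ r with (fun i => decide (Λ i ≠ 0)) ∘ r = ρ, ∑ b, ∑ c,
        ‖w t (l.castSucc.insertNth (α := fun _ => Fin N) b
          (l.insertNth (α := fun _ => Fin N) c r))‖ ^ 2 ≤ K ^ 2) {t : ℝ} (ht : 0 ≤ t) :
    (∀ ρ, ∑ a with (fun i => decide (Λ i ≠ 0)) ∘ a = ρ, ‖u t a‖ ^ 2 ≤ (‖F‖ * K / δ) ^ 2) ∧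
      ∀ a, (∀ l, Λ (a l) = 0) → u t a = 0 := by
  -- contractions into a slot with `Λ = 0` vanish
  have hslot : ∀ t : ℝ, 0 ≤ t → ∀ (a : Fin (m + 1) → Fin N) (l : Fin (m + 1)), Λ (a l) = 0 →
      ∑ b, ∑ c, F (a l) (b, c) * w t (splitSlot l b c a) = 0 := fun t ht a l hl =>
    slot_eq_zero_of_antisymm F (hw t ht) a l (hF _ hl)
  have hzero : ∀ t : ℝ, 0 ≤ t → ∀ a, (∀ l, Λ (a l) = 0) → u t a = 0 := by
    intro t ht a ha
    refine eq_zero_of_hasDerivWithinAt_mul (u := fun s => u s a) (μ := 0) (h0 a)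
      (fun s hs => ?_) ht
    have h := hu s hs a
    have h1 : quadAct F (w s) a = 0 := Finset.sum_eq_zero fun l _ => hslot s hs a l (ha l)
    simpa [h1, ha] using h
  refine ⟨fun ρ => ?_, hzero t ht⟩
  set φ : Fin N → Bool := fun i => decide (Λ i ≠ 0) with hφ
  set S : Finset (Fin (m + 1)) := Finset.univ.filter fun l => ρ l = true with hS
  have hmem : ∀ a, φ ∘ a = ρ → ∀ l, l ∈ S ↔ Λ (a l) ≠ 0 := by
    rintro a rfl l
    simp [hS, hφ]
  rcases S.eq_empty_or_nonempty with hSe | hSn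
  · -- no decaying slot
    rw [Finset.sum_eq_zero]
    · positivity
    · intro a ha
      have ha' := hmem a (Finset.mem_filter.1 ha).2
      rw [hzero t ht a fun l => ?_]
      · simp
      · by_contra h
        have := (ha' l).2 h
        simp [hSe] at this
  · have hn : (0 : ℝ) < S.card := by exact_mod_cast hSn.card_pos
    have hfinal := sum_norm_sq_le_of_decay (Finset.univ.filter fun a => φ ∘ a = ρ)
      (v := u) (g := fun t a => quadAct F (w t) a) (μ := fun a => ∑ l, Λ (a l))
      (c := S.card * δ) (G := S.card * (‖F‖ * K)) (by positivity) ?_ (fun a _ => h0 a)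
      (fun t ht a _ => hu t ht a) ?_ ht
    · rwa [mul_div_mul_left _ _ hn.ne'] at hfinal
    · intro a ha
      have ha' := hmem a (Finset.mem_filter.1 ha).2
      have h1 : ∑ l, Λ (a l) = ∑ l ∈ S, Λ (a l) := by
        symm
        refine Finset.sum_subset (Finset.subset_univ S) fun l _ hl => ?_
        by_contra h
        exact hl ((ha' l).2 h)
      rw [h1, Complex.re_sum]
      refine (Finset.sum_le_sum fun l hl => hre _ ((ha' l).1 hl)).trans (le_of_eq ?_)
      rw [Finset.sum_const, nsmul_eq_mul, mul_neg]
    · intro τ hτ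
      have h1 : ∀ a ∈ Finset.univ.filter fun a => φ ∘ a = ρ, ‖quadAct F (w τ) a‖ ^ 2 ≤
          S.card * ∑ l ∈ S, ‖∑ b, ∑ c, F (a l) (b, c) * w τ (splitSlot l b c a)‖ ^ 2 := by
        intro a ha
        have ha' := hmem a (Finset.mem_filter.1 ha).2
        have h2 : quadAct F (w τ) a =
            ∑ l ∈ S, ∑ b, ∑ c, F (a l) (b, c) * w τ (splitSlot l b c a) := by
          symm
          refine Finset.sum_subset (Finset.subset_univ S) fun l _ hl => ?_
          refine hslot τ hτ a l ?_
          by_contra h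
          exact hl ((ha' l).2 h)
        rw [h2]
        exact (pow_le_pow_left₀ (norm_nonneg _) (norm_sum_le _ _) 2).trans
          sq_sum_le_card_mul_sum_sq
      refine (Finset.sum_le_sum h1).trans ?_
      rw [← Finset.mul_sum, Finset.sum_comm]
      have h3 : ∀ l ∈ S, ∑ a with φ ∘ a = ρ,
          ‖∑ b, ∑ c, F (a l) (b, c) * w τ (splitSlot l b c a)‖ ^ 2 ≤ ‖F‖ ^ 2 * K ^ 2 :=
        fun l _ => (sum_slot_sq_le φ F (w τ) l ρ).trans
          (mul_le_mul_of_nonneg_left (hwK τ hτ l _) (sq_nonneg _))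
      refine (mul_le_mul_of_nonneg_left (Finset.sum_le_sum h3) hn.le).trans (le_of_eq ?_)
      rw [Finset.sum_const, nsmul_eq_mul]
      ring

/-- Symmetry is inherited from the level above, by uniqueness for the scalar equations. -/
theorem level_factorsThrough {N j : ℕ} {Λ : Fin N → ℂ} {F : Matrix (Fin N) (Fin N × Fin N) ℂ}
    {u : ℝ → (Fin j → Fin N) → ℂ} {w : ℝ → (Fin (j + 1) → Fin N) → ℂ}
    (h0 : ∀ a, u 0 a = 0)
    (hu : ∀ t : ℝ, 0 ≤ t → ∀ a, HasDerivWithinAt (fun s => u s a)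
      ((∑ l, Λ (a l)) * u t a + quadAct F (w t) a) (Ici 0) t)
    (hw : ∀ t : ℝ, 0 ≤ t → (w t).FactorsThrough entries) {t : ℝ} (ht : 0 ≤ t) :
    (u t).FactorsThrough entries := by
  intro a a' h
  refine sub_eq_zero.1 (eq_zero_of_hasDerivWithinAt_mul (u := fun s => u s a - u s a')
    (μ := ∑ l, Λ (a l)) (by simp [h0]) (fun s hs => ?_) ht)
  convert! (hu s hs a).sub (hu s hs a') using 1
  have h1 : ∑ l, Λ (a l) = ∑ l, Λ (a' l) := sum_factorsThrough Λ j h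
  rw [quadAct_factorsThrough F (hw s hs) h, h1]
  ring

/-- Error bound in the coordinates that diagonalize the linear part. Descending from level `k + 1`,
each step costs `‖F‖ / δ` and, except for the first one, a factor `2`. The classes of multi-indices
number `2 ^ j`, and the class without decaying slots does not contribute. -/
theorem hierarchy_bound {N k : ℕ} {Λ : Fin N → ℂ} {F : Matrix (Fin N) (Fin N × Fin N) ℂ} {δ Y : ℝ}
    (hδ : 0 < δ)
    (hre : ∀ i, Λ i ≠ 0 → (Λ i).re ≤ -δ)
    (hF : ∀ i, Λ i = 0 → ∀ b c, F i (b, c) + F i (c, b) = 0)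
    {E : (j : ℕ) → ℝ → (Fin j → Fin N) → ℂ}
    (h0 : ∀ j, 1 ≤ j → j ≤ k → ∀ a, E j 0 a = 0)
    (hE : ∀ j, 1 ≤ j → j ≤ k → ∀ t : ℝ, 0 ≤ t → ∀ a, HasDerivWithinAt (fun s => E j s a)
      ((∑ l, Λ (a l)) * E j t a + quadAct F (E (j + 1) t) a) (Ici 0) t)
    {z : ℝ → Fin N → ℂ} (hz : ∀ t : ℝ, 0 ≤ t → ∑ i, ‖z t i‖ ^ 2 ≤ Y ^ 2)
    (htop : ∀ t : ℝ, 0 ≤ t → ∀ a, E (k + 1) t a = ∏ l, z t (a l))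
    {j : ℕ} (hj : 1 ≤ j) (hjk : j ≤ k) {t : ℝ} (ht : 0 ≤ t) :
    ∑ a, ‖E j t a‖ ^ 2 ≤ (2 ^ (k - 1) * (‖F‖ / δ) ^ (k + 1 - j) * Y ^ (k + 1)) ^ 2 := by
  -- symmetry descends from the tensor power at level `k + 1`
  have hsymm : ∀ d ≤ k, ∀ t : ℝ, 0 ≤ t → (E (k + 1 - d) t).FactorsThrough entries := by
    intro d
    induction d with
    | zero =>
      intro _ t ht
      have : E (k + 1 - 0) t = fun a => ∏ l, z t (a l) := funext fun a => htop t ht a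
      rw [this]
      exact prod_factorsThrough (z t) _
    | succ d ih =>
      intro hd t ht
      have h1 : k + 1 - d = k + 1 - (d + 1) + 1 := by omega
      have ih' := ih (by omega)
      rw [h1] at ih'
      exact level_factorsThrough (h0 _ (by omega) (by omega)) (hE _ (by omega) (by omega)) ih' ht
  have hsymm' : ∀ m, m ≤ k → ∀ t : ℝ, 0 ≤ t → (E (m + 1) t).FactorsThrough entries := by
    intro m hm t ht
    have h := hsymm (k - m) (by omega) t ht
    rwa [show k + 1 - (k - m) = m + 1 by omega] at h
  have hf : 0 ≤ ‖F‖ / δ := by positivity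
  -- `d` is the number of steps from level `k` down to level `m + 1`
  have hmain : ∀ d m, m + 1 + d = k → ∀ t : ℝ, 0 ≤ t →
      (∀ ρ, ∑ a with (fun i => decide (Λ i ≠ 0)) ∘ a = ρ, ‖E (m + 1) t a‖ ^ 2 ≤
        (2 ^ d * (‖F‖ / δ) ^ (d + 1) * Y ^ (k + 1)) ^ 2) ∧
      ∀ a, (∀ l, Λ (a l) = 0) → E (m + 1) t a = 0 := by
    intro d
    induction d with
    | zero =>
      rintro m rfl t ht
      have h := level_step hδ (K := Y ^ (m + 2)) hre hF
        (h0 (m + 1) (by omega) le_rfl) (hE (m + 1) (by omega) le_rfl) (hsymm' (m + 1) le_rfl)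
        (fun t ht l ρ => ?_) ht
      · refine ⟨fun ρ => (h.1 ρ).trans (le_of_eq ?_), h.2⟩
        ring
      · refine (sum_insertNth_insertNth_le l _ (X := fun a => ‖E (m + 1 + 1) t a‖ ^ 2)
          fun a => sq_nonneg _).trans ?_
        have h1 : ∑ a, ‖E (m + 1 + 1) t a‖ ^ 2 = (∑ i, ‖z t i‖ ^ 2) ^ (m + 1 + 1) := by
          rw [← Fin.prod_const, Fintype.prod_sum]
          refine Finset.sum_congr rfl fun a _ => ?_
          have h2 := htop t ht a
          rw [Finset.prod_pow, ← norm_prod, ← h2]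
        rw [h1, ← pow_mul, mul_comm (m + 2) 2, pow_mul]
        exact pow_le_pow_left₀ (Finset.sum_nonneg fun _ _ => sq_nonneg _) (hz t ht) _
    | succ d ih =>
      intro m hm t ht
      have h := level_step hδ (K := 2 * (2 ^ d * (‖F‖ / δ) ^ (d + 1) * Y ^ (k + 1)))
        hre hF (h0 (m + 1) (by omega) (by omega)) (hE (m + 1) (by omega) (by omega))
        (hsymm' (m + 1) (by omega))
        (fun t ht l ρ => ?_) ht
      · refine ⟨fun ρ => (h.1 ρ).trans (le_of_eq ?_), h.2⟩
        ring
      · refine (sum_free_slots_le _ _ l (ih (m + 1) (by omega) t ht).1 ρ).trans (le_of_eq ?_)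
        ring
  obtain ⟨m, rfl⟩ : ∃ m, j = m + 1 := ⟨j - 1, by omega⟩
  obtain ⟨d, rfl⟩ : ∃ d, k = m + 1 + d := ⟨k - (m + 1), by omega⟩
  obtain ⟨h1, h2⟩ := hmain d m rfl t ht
  have h3 : ∑ a, ‖E (m + 1) t a‖ ^ 2 =
      ∑ ρ : Fin (m + 1) → Bool, ∑ a with (fun i => decide (Λ i ≠ 0)) ∘ a = ρ,
        ‖E (m + 1) t a‖ ^ 2 :=
    (Finset.sum_fiberwise _ _ _).symm
  have h4 : ∑ a with (fun i => decide (Λ i ≠ 0)) ∘ a = (fun _ : Fin (m + 1) => false),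
      ‖E (m + 1) t a‖ ^ 2 = 0 := by
    refine Finset.sum_eq_zero fun a ha => ?_
    rw [h2 a fun l => ?_]
    · simp
    · simpa using congrFun (Finset.mem_filter.1 ha).2 l
  rw [h3, ← Finset.sum_erase (f := fun ρ : Fin (m + 1) → Bool =>
    ∑ a with (fun i => decide (Λ i ≠ 0)) ∘ a = ρ, ‖E (m + 1) t a‖ ^ 2) _ h4]
  refine (Finset.sum_le_sum fun ρ _ => h1 ρ).trans ?_
  rw [Finset.sum_const, Finset.card_erase_of_mem (Finset.mem_univ _), Finset.card_univ,
    Fintype.card_fun, Fintype.card_bool, Fintype.card_fin, nsmul_eq_mul]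
  -- `2 ^ (m + 1) - 1` classes remain
  have h5 : ((2 ^ (m + 1) - 1 : ℕ) : ℝ) ≤ (2 ^ m) ^ 2 := by
    have h6 : 2 ^ (m + 1) - 1 ≤ (2 ^ m) ^ 2 := by
      have h7 : 2 ^ (m + 1) = 2 * 2 ^ m := pow_succ' 2 m
      have h8 := two_mul_le_add_sq (2 ^ m) 1
      omega
    exact_mod_cast h6
  refine (mul_le_mul_of_nonneg_right h5 (sq_nonneg _)).trans (le_of_eq ?_)
  rw [show m + 1 + d - 1 = m + d by omega,
    show m + 1 + d + 1 - (m + 1) = d + 1 by omega, pow_add 2 m d]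
  ring

/-! ### Tensor powers of a matrix -/

/-- The matrix of `P^{⊗ j}` in the coordinates of `Tensor N j`. -/
def tensorMap {N : ℕ} (P : Matrix (Fin N) (Fin N) ℂ) (j : ℕ) :
    Matrix (Fin j → Fin N) (Fin j → Fin N) ℂ :=
  Matrix.of fun a b => ∏ l, P (a l) (b l)

theorem sum_mul_prod_erase {ι κ R : Type*} [Fintype ι] [DecidableEq ι] [Fintype κ] [CommSemiring R]
    (l : ι) (X : κ → R) (Y : ι → κ → R) :
    ∑ b : ι → κ, X (b l) * ∏ m ∈ Finset.univ.erase l, Y m (b m) =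
      (∑ i, X i) * ∏ m ∈ Finset.univ.erase l, ∑ i, Y m i := by
  have h : ∀ b : ι → κ, X (b l) * ∏ m ∈ Finset.univ.erase l, Y m (b m) =
      ∏ m, Function.update Y l X m (b m) := by
    intro b
    rw [← Finset.mul_prod_erase _ _ (Finset.mem_univ l), Function.update_self]
    congr 1
    refine Finset.prod_congr rfl fun m hm => ?_
    rw [Function.update_of_ne (Finset.ne_of_mem_erase hm)]
  rw [Finset.sum_congr rfl fun b _ => h b, ← Fintype.prod_sum,
    ← Finset.mul_prod_erase _ _ (Finset.mem_univ l), Function.update_self]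
  congr 1
  refine Finset.prod_congr rfl fun m hm => ?_
  rw [Function.update_of_ne (Finset.ne_of_mem_erase hm)]

theorem tensorMap_mulVec_prod {N : ℕ} (P : Matrix (Fin N) (Fin N) ℂ) (j : ℕ) (v : Fin N → ℂ)
    (a : Fin j → Fin N) :
    (tensorMap P j *ᵥ fun b => ∏ l, v (b l)) a = ∏ l, (P *ᵥ v) (a l) := by
  simp only [Matrix.mulVec, dotProduct, tensorMap, Matrix.of_apply, ← Finset.prod_mul_distrib]
  rw [Fintype.prod_sum]

theorem tensorMap_mul {N : ℕ} (P Q : Matrix (Fin N) (Fin N) ℂ) (j : ℕ) :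
    tensorMap P j * tensorMap Q j = tensorMap (P * Q) j := by
  ext a c
  simp only [Matrix.mul_apply, tensorMap, Matrix.of_apply, ← Finset.prod_mul_distrib]
  rw [Fintype.prod_sum]

theorem tensorMap_one {N : ℕ} (j : ℕ) : tensorMap (1 : Matrix (Fin N) (Fin N) ℂ) j = 1 := by
  ext a b
  simp only [tensorMap, Matrix.of_apply]
  by_cases h : a = b
  · subst h
    simp
  · obtain ⟨l, hl⟩ := Function.ne_iff.1 h
    rw [Matrix.one_apply_ne h]
    exact Finset.prod_eq_zero (Finset.mem_univ l) (Matrix.one_apply_ne hl)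

theorem sum_norm_tensorMap_sq_le {N : ℕ} (P : Matrix (Fin N) (Fin N) ℂ) (j : ℕ)
    (u : (Fin j → Fin N) → ℂ) :
    ∑ a, ‖(tensorMap P j *ᵥ u) a‖ ^ 2 ≤ (‖P‖ ^ j) ^ 2 * ∑ a, ‖u a‖ ^ 2 := by
  induction j with
  | zero =>
    have h : tensorMap P 0 = 1 := by
      ext a b
      rw [Subsingleton.elim a b]
      simp [tensorMap]
    simp [h]
  | succ j ih =>
    have h1 : ∀ i r, (tensorMap P (j + 1) *ᵥ u)
        ((0 : Fin (j + 1)).insertNth (α := fun _ => Fin N) i r) =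
        ∑ i', P i i' * (tensorMap P j *ᵥ fun r' =>
          u ((0 : Fin (j + 1)).insertNth (α := fun _ => Fin N) i' r')) r := by
      intro i r
      simp only [Matrix.mulVec, dotProduct]
      rw [sum_insertNth 0, Finset.sum_comm]
      refine Finset.sum_congr rfl fun i' _ => ?_
      rw [Finset.mul_sum]
      refine Finset.sum_congr rfl fun r' _ => ?_
      simp only [tensorMap, Matrix.of_apply]
      rw [Fin.prod_univ_succ]
      simp [mul_assoc]
    rw [sum_insertNth 0, sum_insertNth 0]
    simp only [h1]
    calc _ ≤ ∑ r, ‖P‖ ^ 2 * ∑ i', ‖(tensorMap P j *ᵥ fun r' =>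
          u ((0 : Fin (j + 1)).insertNth (α := fun _ => Fin N) i' r')) r‖ ^ 2 :=
          Finset.sum_le_sum fun r _ => sum_norm_mulVec_sq_le P _
      _ = ‖P‖ ^ 2 * ∑ i', ∑ r, ‖(tensorMap P j *ᵥ fun r' =>
          u ((0 : Fin (j + 1)).insertNth (α := fun _ => Fin N) i' r')) r‖ ^ 2 := by
          rw [← Finset.mul_sum, Finset.sum_comm]
      _ ≤ ‖P‖ ^ 2 * ∑ i', (‖P‖ ^ j) ^ 2 * ∑ r,
          ‖u ((0 : Fin (j + 1)).insertNth (α := fun _ => Fin N) i' r)‖ ^ 2 :=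
          mul_le_mul_of_nonneg_left (Finset.sum_le_sum fun i' _ => ih _) (sq_nonneg _)
      _ = _ := by
          rw [← Finset.mul_sum, Finset.sum_comm]
          ring

theorem sum_mul_prod_erase_one {N j : ℕ} (l : Fin j) (X : Fin N → ℂ) (Y : Fin j → Fin N → ℂ)
    (c : Fin j → Fin N) :
    ∑ b : Fin j → Fin N, X (b l) * ∏ m ∈ Finset.univ.erase l,
      (Y m (b m) * (1 : Matrix (Fin N) (Fin N) ℂ) (b m) (c m)) =
      (∑ i, X i) * ∏ m ∈ Finset.univ.erase l, Y m (c m) := by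
  rw [sum_mul_prod_erase l X fun m i => Y m i * (1 : Matrix (Fin N) (Fin N) ℂ) i (c m)]
  simp [Matrix.one_apply]

theorem tensorMap_mul_linBlock {N : ℕ} {P F : Matrix (Fin N) (Fin N) ℂ} {Λ : Fin N → ℂ}
    (h : P * F = Matrix.diagonal Λ * P) (j : ℕ) :
    tensorMap P j * linBlock F j = Matrix.diagonal (fun a => ∑ l, Λ (a l)) * tensorMap P j := by
  ext a c
  rw [Matrix.diagonal_mul, Matrix.mul_apply]
  simp only [linBlock, tensorMap, Matrix.of_apply, Finset.mul_sum, Finset.sum_mul]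
  rw [Finset.sum_comm]
  refine Finset.sum_congr rfl fun l _ => ?_
  have h1 := sum_mul_prod_erase_one l (fun i => P (a l) i * F i (c l)) (fun m => P (a m)) c
  rw [← Matrix.mul_apply, h, Matrix.diagonal_mul, mul_assoc,
    Finset.mul_prod_erase _ (fun m => P (a m) (c m)) (Finset.mem_univ l)] at h1
  rw [← h1]
  refine Finset.sum_congr rfl fun b _ => ?_
  rw [Finset.prod_mul_distrib, ← Finset.mul_prod_erase _ _ (Finset.mem_univ l)]
  ring

theorem tensorMap_mul_quadBlock {N : ℕ} {P : Matrix (Fin N) (Fin N) ℂ}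
    {F F' : Matrix (Fin N) (Fin N × Fin N) ℂ} (h : P * F = F' * (P ⊗ₖ P)) (j : ℕ) :
    tensorMap P j * quadBlock F j = quadBlock F' j * tensorMap P (j + 1) := by
  ext a d
  have hr : (quadBlock F' j * tensorMap P (j + 1)) a d =
      quadAct F' (fun e => ∏ m, P (e m) (d m)) a := by
    rw [← quadBlock_mulVec]
    rfl
  rw [hr, Matrix.mul_apply]
  simp only [quadBlock_apply, quadAct, tensorMap, Matrix.of_apply, Finset.mul_sum]
  rw [Finset.sum_comm]
  refine Finset.sum_congr rfl fun l _ => ?_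
  have h1 := sum_mul_prod_erase_one l
    (fun i => P (a l) i * F i (d l.castSucc, d (l.castSucc.succAbove l))) (fun m => P (a m))
    (fun m => d (l.castSucc.succAbove m))
  rw [← Matrix.mul_apply, h, Matrix.mul_apply, Fintype.sum_prod_type] at h1
  simp only [Finset.sum_mul] at h1
  simp only [prod_splitSlot l _ _ a fun m i => P i (d m)]
  refine Eq.trans ?_ (h1.trans ?_)
  · refine Finset.sum_congr rfl fun b _ => ?_
    rw [Finset.prod_mul_distrib, ← Finset.mul_prod_erase _ _ (Finset.mem_univ l)]
    ring
  · refine Finset.sum_congr rfl fun b _ => Finset.sum_congr rfl fun c _ => ?_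
    rw [Matrix.kroneckerMap_apply]
    ring

/-! ### The error hierarchy of the truncated Carleman system -/

theorem linBlock_mulVec_prod {N : ℕ} (F : Matrix (Fin N) (Fin N) ℂ) (j : ℕ) (v : Fin N → ℂ)
    (a : Fin j → Fin N) :
    (linBlock F j *ᵥ fun b => ∏ l, v (b l)) a =
      ∑ l, (∏ m ∈ Finset.univ.erase l, v (a m)) * (F *ᵥ v) (a l) := by
  simp only [Matrix.mulVec, dotProduct, linBlock, Matrix.of_apply, Finset.sum_mul]
  rw [Finset.sum_comm]
  refine Finset.sum_congr rfl fun l _ => ?_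
  have h1 := sum_mul_prod_erase l (fun i => F (a l) i * v i)
    (fun m i => (1 : Matrix (Fin N) (Fin N) ℂ) (a m) i * v i)
  rw [mul_comm]
  convert! h1 using 1
  · refine Finset.sum_congr rfl fun b _ => ?_
    rw [Finset.prod_mul_distrib, ← Finset.mul_prod_erase _ _ (Finset.mem_univ l)]
    ring
  · simp [Matrix.one_apply]

theorem quadBlock_mulVec_prod {N : ℕ} (F : Matrix (Fin N) (Fin N × Fin N) ℂ) (j : ℕ)
    (v : Fin N → ℂ) (a : Fin j → Fin N) :
    (quadBlock F j *ᵥ fun b => ∏ l, v (b l)) a =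
      ∑ l, (∏ m ∈ Finset.univ.erase l, v (a m)) * (F *ᵥ tensorSq v) (a l) := by
  rw [quadBlock_mulVec]
  simp only [quadAct, prod_splitSlot _ _ _ a fun _ => v]
  refine Finset.sum_congr rfl fun l _ => ?_
  simp only [Matrix.mulVec, dotProduct, Fintype.sum_prod_type, tensorSq, Finset.mul_sum]
  refine Finset.sum_congr rfl fun b _ => Finset.sum_congr rfl fun c _ => ?_
  ring

theorem _root_.HasDerivWithinAt.euclidean_apply {ι : Type*} [Fintype ι]
    {f : ℝ → EuclideanSpace ℂ ι} {f' : EuclideanSpace ℂ ι} {s : Set ℝ} {t : ℝ}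
    (h : HasDerivWithinAt f f' s t) (i : ι) : HasDerivWithinAt (fun τ => f τ i) (f' i) s t :=
  ((EuclideanSpace.proj i : EuclideanSpace ℂ ι →L[ℂ] ℂ).restrictScalars ℝ).hasFDerivAt
    |>.comp_hasDerivWithinAt t h

/-- The coordinates of the `j`-th block of a Carleman vector, `j = 1, …, k`, extended by zero to all
`j`. -/
def blockCoord {N k : ℕ} (y : CarlemanSpace N k) : (j : ℕ) → (Fin j → Fin N) → ℂ
  | 0 => 0
  | j + 1 => fun a => if h : j < k then y ⟨⟨j, h⟩, a⟩ else 0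

theorem blockCoord_succ {N k : ℕ} (y : CarlemanSpace N k) {j : ℕ} (h : j < k)
    (a : Fin (j + 1) → Fin N) : blockCoord y (j + 1) a = y ⟨⟨j, h⟩, a⟩ := by
  simp [blockCoord, h]

theorem carlemanMatrix_mulVec {N : ℕ} (F₁ : Matrix (Fin N) (Fin N) ℂ)
    (F₂ : Matrix (Fin N) (Fin N × Fin N) ℂ) {k : ℕ} (y : CarlemanSpace N k) {j : ℕ} (h : j < k)
    (a : Fin (j + 1) → Fin N) :
    (carlemanMatrix F₁ F₂ k *ᵥ y) ⟨⟨j, h⟩, a⟩ =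
      (linBlock F₁ (j + 1) *ᵥ blockCoord y (j + 1)) a +
        (quadBlock F₂ (j + 1) *ᵥ blockCoord y (j + 2)) a := by
  have hdiag : ∑ b, carlemanMatrix F₁ F₂ k ⟨⟨j, h⟩, a⟩ ⟨⟨j, h⟩, b⟩ * y ⟨⟨j, h⟩, b⟩ =
      (linBlock F₁ (j + 1) *ᵥ blockCoord y (j + 1)) a := by
    refine Finset.sum_congr rfl fun b _ => ?_
    rw [blockCoord_succ y h]
    simp [carlemanMatrix]
  have hother : ∀ j' : Fin k, j' ≠ ⟨j, h⟩ → j'.val ≠ j + 1 →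
      ∑ b, carlemanMatrix F₁ F₂ k ⟨⟨j, h⟩, a⟩ ⟨j', b⟩ * y ⟨j', b⟩ = 0 := by
    intro j' h1 h2
    refine Finset.sum_eq_zero fun b _ => ?_
    have h1' : ¬ j = j'.val := fun h' => h1 (Fin.ext h'.symm)
    simp [carlemanMatrix, h1', h2.symm]
  have hsum : (carlemanMatrix F₁ F₂ k *ᵥ y) ⟨⟨j, h⟩, a⟩ =
      ∑ j', ∑ b, carlemanMatrix F₁ F₂ k ⟨⟨j, h⟩, a⟩ ⟨j', b⟩ * y ⟨j', b⟩ := by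
    simp only [Matrix.mulVec, dotProduct]
    exact Fintype.sum_sigma _
  rw [hsum]
  by_cases h' : j + 1 < k
  · rw [Fintype.sum_eq_add ⟨j, h⟩ ⟨j + 1, h'⟩ (by simp) fun j' hj' =>
      hother j' hj'.1 fun h2 => hj'.2 (Fin.ext h2), hdiag]
    congr 1
    refine Finset.sum_congr rfl fun b _ => ?_
    rw [blockCoord_succ y h']
    simp [carlemanMatrix]
  · rw [Fintype.sum_eq_single ⟨j, h⟩ fun j' hj' => hother j' hj' (by omega), hdiag]
    have : blockCoord y (j + 2) = 0 := by
      funext b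
      simp [blockCoord, h']
    rw [this, Matrix.mulVec_zero, Pi.zero_apply, add_zero]

theorem hasDerivWithinAt_prod_sub_blockCoord {N k : ℕ} {F₁ : Matrix (Fin N) (Fin N) ℂ}
    {F₂ : Matrix (Fin N) (Fin N × Fin N) ℂ} {x : ℝ → Vec N} {y : ℝ → CarlemanSpace N k} {x₀ : Vec N}
    (hx : IsQuadSolution F₁ F₂ x) (hy : IsCarlemanSolution F₁ F₂ k x₀ y)
    {j : ℕ} (hj : 1 ≤ j) (hjk : j ≤ k) {t : ℝ} (ht : 0 ≤ t) (a : Fin j → Fin N) :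
    HasDerivWithinAt (fun s => ∏ l, x s (a l) - blockCoord (y s) j a)
      ((linBlock F₁ j *ᵥ fun b => ∏ l, x t (b l) - blockCoord (y t) j b) a +
        (quadBlock F₂ j *ᵥ fun b => ∏ l, x t (b l) - blockCoord (y t) (j + 1) b) a)
      (Ici 0) t := by
  obtain ⟨j, rfl⟩ : ∃ i, j = i + 1 := ⟨j - 1, by omega⟩
  have hx' : ∀ i, HasDerivWithinAt (fun s => x s i) (quadField F₁ F₂ (x t) i) (Ici 0) t :=
    fun i => (hx t ht).euclidean_apply i
  have hy' : HasDerivWithinAt (fun s => blockCoord (y s) (j + 1) a)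
      ((carlemanMatrix F₁ F₂ k *ᵥ y t) ⟨⟨j, hjk⟩, a⟩) (Ici 0) t := by
    simp only [blockCoord_succ _ (Nat.lt_of_succ_le hjk)]
    exact (hy.2 t ht).euclidean_apply _
  have hp := HasDerivWithinAt.fun_finsetProd (u := Finset.univ) (f := fun l s => x s (a l))
    fun l _ => hx' (a l)
  have hsub : ∀ i, (fun b : Fin i → Fin N => ∏ l, x t (b l) - blockCoord (y t) i b) =
      (fun b => ∏ l, x t (b l)) - blockCoord (y t) i := fun _ => rfl
  convert! hp.sub hy' using 1
  rw [carlemanMatrix_mulVec, hsub, hsub, Matrix.mulVec_sub, Matrix.mulVec_sub, Pi.sub_apply,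
    Pi.sub_apply, linBlock_mulVec_prod, quadBlock_mulVec_prod]
  simp only [quadField, Pi.add_apply, smul_eq_mul, mul_add, Finset.sum_add_distrib]
  ring

/-- Error bound for the Carleman blocks of a solution `x` whose transform `Q⁻¹ x` stays in the ball
of radius `Y`. -/
theorem norm_blockError_le {N k : ℕ} {F₁ : Matrix (Fin N) (Fin N) ℂ}
    {F₂ : Matrix (Fin N) (Fin N × Fin N) ℂ} {x : ℝ → Vec N} {y : ℝ → CarlemanSpace N k}
    (hx : IsQuadSolution F₁ F₂ x) (hy : IsCarlemanSolution F₁ F₂ k (x 0) y)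
    {Q : Matrix (Fin N) (Fin N) ℂ} {Λ : Fin N → ℂ} (hQ : IsUnit Q)
    (hF₁ : F₁ = Q * Matrix.diagonal Λ * Q⁻¹) {δ Y : ℝ} (hδ : 0 < δ) (hY : 0 ≤ Y)
    (hre : ∀ i, Λ i ≠ 0 → (Λ i).re ≤ -δ)
    (hF : ∀ i, Λ i = 0 → ∀ b c, conjQuad Q F₂ i (b, c) + conjQuad Q F₂ i (c, b) = 0)
    (hxY : ∀ t : ℝ, 0 ≤ t → ‖(WithLp.toLp 2 (Q⁻¹ *ᵥ x t) : Vec N)‖ ≤ Y)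
    (j : Fin k) {t : ℝ} (ht : 0 ≤ t) :
    ‖blockError x y j t‖ ≤ ‖Q‖ ^ (j.val + 1) *
      (2 ^ (k - 1) * (‖conjQuad Q F₂‖ / δ) ^ (k - j.val) * Y ^ (k + 1)) := by
  have hdet : IsUnit Q.det := (Matrix.isUnit_iff_isUnit_det Q).1 hQ
  have hPQ : Q⁻¹ * Q = 1 := Matrix.nonsing_inv_mul Q hdet
  have hQP : Q * Q⁻¹ = 1 := Matrix.mul_nonsing_inv Q hdet
  have hlin : Q⁻¹ * F₁ = Matrix.diagonal Λ * Q⁻¹ := by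
    rw [hF₁, ← Matrix.mul_assoc, ← Matrix.mul_assoc, hPQ, Matrix.one_mul]
  have hquad : Q⁻¹ * F₂ = conjQuad Q F₂ * (Q⁻¹ ⊗ₖ Q⁻¹) := by
    rw [conjQuad, Matrix.mul_assoc, ← Matrix.mul_kronecker_mul, hQP, Matrix.one_kronecker_one,
      Matrix.mul_one]
  -- the errors in the original coordinates; above level `k` this is the full tensor power
  set D : (i : ℕ) → ℝ → (Fin i → Fin N) → ℂ :=
    fun i s a => ∏ l, x s (a l) - blockCoord (y s) i a with hD
  have hmain := hierarchy_bound (k := k) (Λ := Λ) (F := conjQuad Q F₂) (δ := δ) (Y := Y) hδ hre hF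
    (E := fun i s => tensorMap Q⁻¹ i *ᵥ D i s) (z := fun s => Q⁻¹ *ᵥ x s) ?_ ?_ ?_ ?_
    (j := j.val + 1) (by omega) (by omega) ht
  · have hinv : tensorMap Q (j.val + 1) *ᵥ (tensorMap Q⁻¹ (j.val + 1) *ᵥ D (j.val + 1) t) =
        D (j.val + 1) t := by
      rw [Matrix.mulVec_mulVec, tensorMap_mul, hQP, tensorMap_one, Matrix.one_mulVec]
    have h1 := sum_norm_tensorMap_sq_le Q (j.val + 1)
      (tensorMap Q⁻¹ (j.val + 1) *ᵥ D (j.val + 1) t)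
    rw [hinv] at h1
    have h2 : ‖blockError x y j t‖ ^ 2 = ∑ a, ‖D (j.val + 1) t a‖ ^ 2 := by
      rw [EuclideanSpace.norm_sq_eq]
      refine Finset.sum_congr rfl fun a _ => ?_
      simp only [hD, blockCoord_succ _ j.2]
      rfl
    rw [Nat.add_sub_add_right] at hmain
    refine le_of_sq_le_sq ?_ (by positivity)
    rw [h2, mul_pow]
    exact h1.trans (mul_le_mul_of_nonneg_left hmain (sq_nonneg _))
  · intro i hi hik a
    obtain ⟨i, rfl⟩ : ∃ i', i = i' + 1 := ⟨i - 1, by omega⟩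
    have h1 : D (i + 1) 0 = 0 := by
      funext b
      simp only [hD, blockCoord_succ _ (Nat.lt_of_succ_le hik), hy.1]
      exact sub_self _
    simp [h1]
  · intro i hi hik s hs a
    have hd : HasDerivWithinAt (fun s => (tensorMap Q⁻¹ i *ᵥ D i s) a)
        ((tensorMap Q⁻¹ i *ᵥ (linBlock F₁ i *ᵥ D i s + quadBlock F₂ i *ᵥ D (i + 1) s)) a)
        (Ici 0) s :=
      HasDerivWithinAt.fun_sum fun b _ =>
        (hasDerivWithinAt_prod_sub_blockCoord hx hy hi hik hs b).const_mul _
    convert! hd using 1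
    rw [Matrix.mulVec_add, Matrix.mulVec_mulVec, Matrix.mulVec_mulVec, tensorMap_mul_linBlock hlin,
      tensorMap_mul_quadBlock hquad, ← Matrix.mulVec_mulVec, ← Matrix.mulVec_mulVec,
      quadBlock_mulVec, Pi.add_apply, Matrix.mulVec_diagonal]
  · intro s hs
    have h := pow_le_pow_left₀ (norm_nonneg _) (hxY s hs) 2
    rwa [EuclideanSpace.norm_sq_eq] at h
  · intro s hs a
    have h1 : D (k + 1) s = fun b => ∏ l, x s (b l) := by
      funext b
      simp [hD, blockCoord]
    rw [h1]
    exact tensorMap_mulVec_prod _ _ _ _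

/-! ### Spectral gap, conserved quantities and rescaling -/

theorem re_le_neg_realSpectralGap {N : ℕ} {F₁ Q : Matrix (Fin N) (Fin N) ℂ} {Λ : Fin N → ℂ}
    (hQ : IsUnit Q) (hF₁ : F₁ = Q * Matrix.diagonal Λ * Q⁻¹) {i : Fin N} (hi : (Λ i).re ≠ 0) :
    (Λ i).re ≤ -realSpectralGap F₁ := by
  rw [realSpectralGap, neg_neg]
  refine le_csSup ?_ ⟨hi, Λ i, ?_, rfl⟩
  · refine ((Matrix.finite_spectrum F₁).image Complex.re).bddAbove.mono ?_
    rintro r ⟨-, μ, hμ, rfl⟩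
    exact ⟨μ, hμ, rfl⟩
  · obtain ⟨U, rfl⟩ := hQ
    rw [hF₁, ← Matrix.coe_units_inv, spectrum.units_conjugate, spectrum_diagonal]
    exact ⟨i, rfl⟩

theorem star_dotProduct_eq_zero_of_mem_span {N M : ℕ} {q : Fin M → Fin N → ℂ} {v : Fin N → ℂ}
    (hq : ∀ m, star (q m) ⬝ᵥ v = 0) {w : Fin N → ℂ} (hw : w ∈ Submodule.span ℂ (Set.range q)) :
    star w ⬝ᵥ v = 0 := by
  induction hw using Submodule.span_induction with
  | mem w h =>
    obtain ⟨m, rfl⟩ := h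
    exact hq m
  | zero => simp
  | add w w' _ _ h h' => rw [star_add, add_dotProduct, h, h', add_zero]
  | smul c w _ h => rw [star_smul, smul_dotProduct, h, smul_zero]

/-- A matrix row that vanishes on all `v ⊗ v` is antisymmetric, by polarization. -/
theorem antisymm_of_mulVec_tensorSq {N : ℕ} {F : Matrix (Fin N) (Fin N × Fin N) ℂ} {i : Fin N}
    (h : ∀ v, (F *ᵥ tensorSq v) i = 0) (b c : Fin N) : F i (b, c) + F i (c, b) = 0 := by
  have hs : ∀ b c : Fin N, ∑ b', ∑ c', F i (b', c') *
      ((Pi.single b (1 : ℂ) : Fin N → ℂ) b' * (Pi.single c (1 : ℂ) : Fin N → ℂ) c') =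
      F i (b, c) := by
    intro b c
    simp [Pi.single_apply]
  have hval : ∀ v : Fin N → ℂ, ∑ b', ∑ c', F i (b', c') * (v b' * v c') = 0 := by
    intro v
    rw [← h v]
    simp [Matrix.mulVec, dotProduct, Fintype.sum_prod_type, tensorSq]
  have h1 := hval (Pi.single b 1)
  have h2 := hval (Pi.single c 1)
  have h3 := hval (Pi.single b 1 + Pi.single c 1)
  simp only [Pi.add_apply, add_mul, mul_add, Finset.sum_add_distrib] at h3
  rw [hs] at h1 h2
  rw [hs, hs, hs, hs, h1, h2] at h3
  linear_combination h3

/-- The rows of `Q⁻¹` belonging to the eigenvalue `0` are left null vectors of `F₁`, hence conserved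
quantities; so the quadratic term of the diagonalized system has no symmetric part in these
rows. -/
theorem conjQuad_antisymm {N M : ℕ} {F₁ : Matrix (Fin N) (Fin N) ℂ}
    {F₂ : Matrix (Fin N) (Fin N × Fin N) ℂ} {q : Fin M → Fin N → ℂ}
    (hq : ∀ m, IsLinearConserved F₁ F₂ (q m)) {Q : Matrix (Fin N) (Fin N) ℂ} {Λ : Fin N → ℂ}
    (hQ : IsUnit Q) (hF₁ : F₁ = Q * Matrix.diagonal Λ * Q⁻¹)
    (hzero : ∀ w : Fin N → ℂ, star w ᵥ* F₁ = 0 → w ∈ Submodule.span ℂ (Set.range q))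
    {i : Fin N} (hi : Λ i = 0) (b c : Fin N) :
    conjQuad Q F₂ i (b, c) + conjQuad Q F₂ i (c, b) = 0 := by
  have hPQ : Q⁻¹ * Q = 1 := Matrix.nonsing_inv_mul Q ((Matrix.isUnit_iff_isUnit_det Q).1 hQ)
  have hrow : Q⁻¹ i ᵥ* F₁ = 0 := by
    have h1 : Q⁻¹ * F₁ = Matrix.diagonal Λ * Q⁻¹ := by
      rw [hF₁, ← Matrix.mul_assoc, ← Matrix.mul_assoc, hPQ, Matrix.one_mul]
    funext c
    have h2 := congrFun (congrFun h1 i) c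
    rw [Matrix.diagonal_mul, hi, zero_mul] at h2
    exact h2
  have hmem := hzero (star (Q⁻¹ i)) (by rwa [star_star])
  refine antisymm_of_mulVec_tensorSq (fun v => ?_) b c
  have h3 := star_dotProduct_eq_zero_of_mem_span (fun m => hq m (Q *ᵥ v)) hmem
  rw [star_star, quadField, dotProduct_add, Matrix.dotProduct_mulVec, hrow, zero_dotProduct,
    zero_add] at h3
  have h4 : (Q ⊗ₖ Q) *ᵥ tensorSq v = tensorSq (Q *ᵥ v) := by
    funext a
    simp only [Matrix.mulVec, dotProduct, Fintype.sum_prod_type, tensorSq,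
      Matrix.kroneckerMap_apply, Finset.sum_mul_sum]
    refine Finset.sum_congr rfl fun b _ => Finset.sum_congr rfl fun c _ => ?_
    ring
  rw [conjQuad, ← Matrix.mulVec_mulVec, h4, ← Matrix.mulVec_mulVec]
  exact h3

theorem IsQuadSolution.rescale {N : ℕ} {F₁ : Matrix (Fin N) (Fin N) ℂ}
    {F₂ : Matrix (Fin N) (Fin N × Fin N) ℂ} {x : ℝ → Vec N} (hx : IsQuadSolution F₁ F₂ x) {γ : ℝ}
    (hγ : γ ≠ 0) : IsQuadSolution F₁ (γ⁻¹ • F₂) fun s => γ • x s := by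
  intro t ht
  have h := (hx t ht).const_smul γ
  convert! h using 1
  have h1 : tensorSq ((γ • x t : Vec N) : Fin N → ℂ) = (γ * γ) • tensorSq (x t) := by
    funext a
    simp only [tensorSq, PiLp.smul_apply, Pi.smul_apply, Complex.real_smul]
    push_cast
    ring
  have h2 : quadField F₁ (γ⁻¹ • F₂) ((γ • x t : Vec N) : Fin N → ℂ) =
      γ • quadField F₁ F₂ (x t) := by
    rw [quadField, quadField, h1, Matrix.mulVec_smul, Matrix.smul_mulVec, smul_smul, smul_add,
      WithLp.ofLp_smul, Matrix.mulVec_smul, mul_assoc, mul_inv_cancel₀ hγ, mul_one]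
  rw [h2]
  rfl

/-- Error bound for the Carleman blocks of the system rescaled by `γ`. -/
theorem norm_blockError_rescale_le {N k : ℕ} {F₁ : Matrix (Fin N) (Fin N) ℂ}
    {F₂ : Matrix (Fin N) (Fin N × Fin N) ℂ} {x : ℝ → Vec N} (hx : IsQuadSolution F₁ F₂ x)
    {Q : Matrix (Fin N) (Fin N) ℂ} {Λ : Fin N → ℂ} (hQ : IsUnit Q)
    (hF₁ : F₁ = Q * Matrix.diagonal Λ * Q⁻¹) {δ X γ : ℝ} (hδ : 0 < δ) (hγ : 0 < γ)
    (hre : ∀ i, Λ i ≠ 0 → (Λ i).re ≤ -δ)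
    (hF : ∀ i, Λ i = 0 → ∀ b c, conjQuad Q F₂ i (b, c) + conjQuad Q F₂ i (c, b) = 0)
    (hX : ∀ t : ℝ, 0 ≤ t → ‖(WithLp.toLp 2 (Q⁻¹ *ᵥ x t) : Vec N)‖ ≤ X)
    {y : ℝ → CarlemanSpace N k} (hy : IsCarlemanSolution F₁ (γ⁻¹ • F₂) k (γ • x 0) y)
    (j : Fin k) {t : ℝ} (ht : 0 ≤ t) :
    ‖blockError (fun s => γ • x s) y j t‖ ≤ (γ * ‖Q‖) ^ (j.val + 1) *
      (2 ^ (k - 1) * (‖conjQuad Q F₂‖ / δ) ^ (k - j.val) * X ^ (k + 1)) := by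
  have hX0 : 0 ≤ X := (norm_nonneg _).trans (hX 0 le_rfl)
  have hconj : conjQuad Q (γ⁻¹ • F₂) = γ⁻¹ • conjQuad Q F₂ := by
    simp [conjQuad]
  have h := norm_blockError_le (hx.rescale hγ.ne') hy hQ hF₁ hδ (Y := γ * X) (by positivity) hre
    (fun i hi b c => ?_) (fun s hs => ?_) j ht
  · refine h.trans (le_of_eq ?_)
    rw [hconj, norm_smul, norm_inv, Real.norm_of_nonneg hγ.le, mul_pow γ X]
    have h1 : γ ^ (k + 1) = γ ^ (j.val + 1) * γ ^ (k - j.val) := by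
      rw [← pow_add]
      congr 1
      omega
    rw [h1, mul_div_assoc, mul_pow, inv_pow]
    field_simp
    ring
  · rw [hconj]
    simp only [Matrix.smul_apply, ← smul_add, hF i hi b c, smul_zero]
  · have h1 : (WithLp.toLp 2 (Q⁻¹ *ᵥ (γ • x s : Vec N)) : Vec N) =
        γ • WithLp.toLp 2 (Q⁻¹ *ᵥ x s) := by
      rw [WithLp.ofLp_smul, Matrix.mulVec_smul]
      rfl
    rw [h1, norm_smul, Real.norm_of_nonneg hγ.le]
    exact mul_le_mul_of_nonneg_left (hX s hs) hγ.le

theorem norm_carlemanError_le {N k : ℕ} {x : ℝ → Vec N} {y : ℝ → CarlemanSpace N k} {t C : ℝ}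
    (hC : 0 ≤ C) (h : ∀ j, ‖blockError x y j t‖ ≤ C) : ‖carlemanError x y t‖ ≤ k * C := by
  refine le_of_sq_le_sq ?_ (by positivity)
  have h1 : ‖carlemanError x y t‖ ^ 2 = ∑ j, ‖blockError x y j t‖ ^ 2 := by
    simp only [EuclideanSpace.norm_sq_eq]
    exact Fintype.sum_sigma _
  rw [h1]
  calc ∑ j, ‖blockError x y j t‖ ^ 2 ≤ ∑ _j : Fin k, C ^ 2 :=
        Finset.sum_le_sum fun j _ => pow_le_pow_left₀ (norm_nonneg _) (h j) 2
    _ = k * C ^ 2 := by simp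
    _ ≤ (k * k) * C ^ 2 := by
        gcongr
        exact_mod_cast Nat.le_mul_self k
    _ = (k * C) ^ 2 := by ring

/-- Comparison of constants behind the bound for all blocks. With `i = j + 1` and `n = k + 1` it
comes down to `n / i ≤ 1 + (n - i) ≤ exp (n - i)`. -/
theorem block_constant_le {j k : ℕ} (hjk : j < k) {p g X : ℝ} (hp : 0 ≤ p) (hg : 0 ≤ g)
    (hX : 0 ≤ X) :
    (p * (Real.exp 1 * g)) ^ (j + 1) * (2 ^ (k - 1) * g ^ (k - j) * X ^ (k + 1)) ≤
      ((j + 1 : ℕ) : ℝ) / (2 * ((k : ℝ) + 1)) * p ^ (j + 1) *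
        (2 * Real.exp 1 * X * g) ^ (k + 1) := by
  obtain ⟨d, rfl⟩ : ∃ d, k = j + 1 + d := ⟨k - (j + 1), by omega⟩
  have he : (d : ℝ) + 1 + 1 ≤ Real.exp 1 ^ (d + 1) := by
    rw [← Real.exp_nat_mul, mul_one]
    have := Real.add_one_le_exp ((d + 1 : ℕ) : ℝ)
    push_cast at this ⊢
    exact this
  have hk : ((j + 1 + d : ℕ) : ℝ) + 1 ≤ ((j + 1 : ℕ) : ℝ) * (2 * Real.exp 1 ^ (d + 1)) := by
    have h1 : ((j + 1 + d : ℕ) : ℝ) + 1 ≤ ((j + 1 : ℕ) : ℝ) * ((d : ℝ) + 1 + 1) := by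
      push_cast
      have : (0 : ℝ) ≤ j * d := by positivity
      nlinarith
    refine h1.trans (mul_le_mul_of_nonneg_left ?_ (by positivity))
    linarith
  have hc : (1 : ℝ) ≤
      ((j + 1 : ℕ) : ℝ) / (((j + 1 + d : ℕ) : ℝ) + 1) * (2 * Real.exp 1 ^ (d + 1)) := by
    rw [div_mul_eq_mul_div, le_div_iff₀ (by positivity), one_mul]
    exact hk
  have hB : 0 ≤ (p * (Real.exp 1 * g)) ^ (j + 1) *
      (2 ^ (j + d) * g ^ (d + 1) * X ^ (j + 1 + d + 1)) := by positivity
  rw [show j + 1 + d - 1 = j + d by omega, show j + 1 + d - j = d + 1 by omega]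
  refine (le_mul_of_one_le_left hB hc).trans (le_of_eq ?_)
  field_simp
  ring

theorem first_block_constant_le {k : ℕ} (hk : 0 < k) {p g X : ℝ} (hp : 0 ≤ p) (hg : 0 ≤ g)
    (hX : 0 ≤ X) :
    p * (16 * g) * (2 ^ (k - 1) * g ^ k * X ^ (k + 1)) ≤ p * (4 * X * g) ^ (k + 1) := by
  obtain ⟨d, rfl⟩ : ∃ d, k = d + 1 := ⟨k - 1, by omega⟩
  have h : (2 : ℝ) ^ d ≤ 4 ^ d := pow_le_pow_left₀ (by norm_num) (by norm_num) d
  calc _ = 16 * (p * g ^ (d + 2) * X ^ (d + 2)) * 2 ^ d := by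
        rw [Nat.add_sub_cancel]
        ring
    _ ≤ 16 * (p * g ^ (d + 2) * X ^ (d + 2)) * 4 ^ d := by gcongr
    _ = _ := by ring

/-- The choice of the rescaling; its positivity excludes the junk values of the quotients. -/
theorem rescaling_pos_and_mul_norm {N : ℕ} {Q : Matrix (Fin N) (Fin N) ℂ} {p γ C f δ : ℝ}
    (hp : 0 < p) (hγ : 0 < γ) (hC : 0 ≤ C) (hf : 0 ≤ f) (h : γ = p * (C * f / (δ * ‖Q‖))) :
    0 < δ ∧ γ * ‖Q‖ = p * (C * (f / δ)) := by
  have h1 : 0 < C * f / (δ * ‖Q‖) := pos_of_mul_pos_right (h ▸ hγ) hp.le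
  have h2 : 0 < δ * ‖Q‖ := by
    by_contra h3
    exact h1.not_ge (div_nonpos_of_nonneg_of_nonpos (mul_nonneg hC hf) (not_lt.1 h3))
  have hδ : 0 < δ := pos_of_mul_pos_left h2 (norm_nonneg Q)
  have hQ : 0 < ‖Q‖ := pos_of_mul_pos_right h2 hδ.le
  refine ⟨hδ, ?_⟩
  rw [h]
  field_simp

end CarlemanODE

theorem theorem2 {N M : ℕ}
    (F₁ : Matrix (Fin N) (Fin N) ℂ) (F₂ : Matrix (Fin N) (Fin N × Fin N) ℂ)
    (x : ℝ → CarlemanODE.Vec N) (hx : CarlemanODE.IsQuadSolution F₁ F₂ x)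
    -- the linear conserved quantities
    (q : Fin M → Fin N → ℂ) (hq : ∀ m, CarlemanODE.IsLinearConserved F₁ F₂ (q m))
    -- `F₁` is diagonalized by `Q`
    (Q : Matrix (Fin N) (Fin N) ℂ) (Λ : Fin N → ℂ) (hQ : IsUnit Q)
    (hF₁ : F₁ = Q * Matrix.diagonal Λ * Q⁻¹)
    -- the only eigenvalues with non-negative real part are zero ...
    (hre : ∀ i, 0 ≤ (Λ i).re → Λ i = 0)
    -- ... and these come from the conserved quantities
    (hzero : ∀ w : Fin N → ℂ, star w ᵥ* F₁ = 0 → w ∈ Submodule.span ℂ (Set.range q))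
    -- the transformed solution is bounded by `X`
    (X : ℝ) (hX : ∀ t : ℝ, 0 ≤ t → ‖(WithLp.toLp 2 (Q⁻¹ *ᵥ x t) : CarlemanODE.Vec N)‖ ≤ X) :
    let f := ‖CarlemanODE.conjQuad Q F₂‖
    let δ := CarlemanODE.realSpectralGap F₁
    -- all blocks
    (∀ p γ : ℝ, 0 < p → p ≤ 1 → 0 < γ → γ = p * (Real.exp 1 * f / (δ * ‖Q‖)) →
      (∀ (k : ℕ) (y : ℝ → CarlemanODE.CarlemanSpace N k),
        CarlemanODE.IsCarlemanSolution F₁ (γ⁻¹ • F₂) k (γ • x 0) y →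
        ∀ (j : Fin k) (t : ℝ), 0 ≤ t →
          ‖CarlemanODE.blockError (fun s => γ • x s) y j t‖ ≤
            ((j.val + 1 : ℕ) : ℝ) / (2 * ((k : ℝ) + 1)) * p ^ (j.val + 1) *
              (2 * Real.exp 1 * X * f / δ) ^ (k + 1)) ∧
      (2 * Real.exp 1 * X * f / δ < 1 →
        ∀ y : (k : ℕ) → ℝ → CarlemanODE.CarlemanSpace N k,
          (∀ k, CarlemanODE.IsCarlemanSolution F₁ (γ⁻¹ • F₂) k (γ • x 0) (y k)) →
          ∀ t : ℝ, 0 ≤ t →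
            Tendsto (fun k => ‖CarlemanODE.carlemanError (fun s => γ • x s) (y k) t‖)
              atTop (𝓝 0))) ∧
    -- the improvement for the first block
    (∀ p γ : ℝ, 0 < p → p ≤ 1 → 0 < γ → γ = p * (16 * f / (δ * ‖Q‖)) →
      (∀ (k : ℕ) (hk : 0 < k) (y : ℝ → CarlemanODE.CarlemanSpace N k),
        CarlemanODE.IsCarlemanSolution F₁ (γ⁻¹ • F₂) k (γ • x 0) y →
        ∀ t : ℝ, 0 ≤ t →
          ‖CarlemanODE.blockError (fun s => γ • x s) y ⟨0, hk⟩ t‖ ≤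
            p * (4 * X * f / δ) ^ (k + 1)) ∧
      (4 * X * f / δ < 1 →
        ∀ y : (k : ℕ) → ℝ → CarlemanODE.CarlemanSpace N (k + 1),
          (∀ k, CarlemanODE.IsCarlemanSolution F₁ (γ⁻¹ • F₂) (k + 1) (γ • x 0) (y k)) →
          ∀ t : ℝ, 0 ≤ t →
            Tendsto (fun k => ‖CarlemanODE.blockError (fun s => γ • x s) (y k) 0 t‖)
              atTop (𝓝 0))) := by
  intro f δ
  have hf : 0 ≤ f := norm_nonneg _
  have hX0 : 0 ≤ X := (norm_nonneg _).trans (hX 0 le_rfl)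
  have hreδ : ∀ i, Λ i ≠ 0 → (Λ i).re ≤ -δ := fun i hi =>
    CarlemanODE.re_le_neg_realSpectralGap hQ hF₁ fun h => hi (hre i h.ge)
  have hanti : ∀ i, Λ i = 0 → ∀ b c,
      CarlemanODE.conjQuad Q F₂ i (b, c) + CarlemanODE.conjQuad Q F₂ i (c, b) = 0 :=
    fun i hi => CarlemanODE.conjQuad_antisymm hq hQ hF₁ hzero hi
  constructor
  · intro p γ hp hp1 hγ hγp
    obtain ⟨hδ, hγQ⟩ :=
      CarlemanODE.rescaling_pos_and_mul_norm hp hγ (Real.exp_pos 1).le hf hγp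
    have hg : 0 ≤ f / δ := div_nonneg hf hδ.le
    have hblock : ∀ (k : ℕ) (y : ℝ → CarlemanODE.CarlemanSpace N k),
        CarlemanODE.IsCarlemanSolution F₁ (γ⁻¹ • F₂) k (γ • x 0) y →
        ∀ (j : Fin k) (t : ℝ), 0 ≤ t →
          ‖CarlemanODE.blockError (fun s => γ • x s) y j t‖ ≤
            ((j.val + 1 : ℕ) : ℝ) / (2 * ((k : ℝ) + 1)) * p ^ (j.val + 1) *
              (2 * Real.exp 1 * X * f / δ) ^ (k + 1) := by
      intro k y hy j t ht
      have h := CarlemanODE.norm_blockError_rescale_le hx hQ hF₁ hδ hγ hreδ hanti hX hy j ht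
      rw [hγQ] at h
      rw [mul_div_assoc]
      exact h.trans (CarlemanODE.block_constant_le j.2 hp.le hg hX0)
    refine ⟨hblock, fun hR y hy t ht => ?_⟩
    have hR0 : 0 ≤ 2 * Real.exp 1 * X * f / δ := by positivity
    refine squeeze_zero (fun _ => norm_nonneg _) (fun k => ?_)
      (tendsto_self_mul_const_pow_of_lt_one hR0 hR)
    refine CarlemanODE.norm_carlemanError_le (pow_nonneg hR0 k) fun j =>
      (hblock k (y k) (hy k) j t ht).trans ?_
    have h1 : ((j.val + 1 : ℕ) : ℝ) / (2 * ((k : ℝ) + 1)) ≤ 1 := by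
      rw [div_le_one (by positivity)]
      have h2 : ((j.val + 1 : ℕ) : ℝ) ≤ k := by exact_mod_cast j.2
      have h3 : (0 : ℝ) ≤ k := Nat.cast_nonneg k
      linarith
    have h4 : ((j.val + 1 : ℕ) : ℝ) / (2 * ((k : ℝ) + 1)) * p ^ (j.val + 1) ≤ 1 :=
      mul_le_one₀ h1 (by positivity) (pow_le_one₀ hp.le hp1)
    exact (mul_le_of_le_one_left (by positivity) h4).trans
      (pow_le_pow_of_le_one hR0 hR.le (Nat.le_succ k))
  · intro p γ hp hp1 hγ hγp
    obtain ⟨hδ, hγQ⟩ :=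
      CarlemanODE.rescaling_pos_and_mul_norm hp hγ (by norm_num : (0 : ℝ) ≤ 16) hf hγp
    have hg : 0 ≤ f / δ := div_nonneg hf hδ.le
    have hblock : ∀ (k : ℕ) (hk : 0 < k) (y : ℝ → CarlemanODE.CarlemanSpace N k),
        CarlemanODE.IsCarlemanSolution F₁ (γ⁻¹ • F₂) k (γ • x 0) y →
        ∀ t : ℝ, 0 ≤ t →
          ‖CarlemanODE.blockError (fun s => γ • x s) y ⟨0, hk⟩ t‖ ≤
            p * (4 * X * f / δ) ^ (k + 1) := by
      intro k hk y hy t ht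
      have h := CarlemanODE.norm_blockError_rescale_le hx hQ hF₁ hδ hγ hreδ hanti hX hy ⟨0, hk⟩ ht
      rw [hγQ] at h
      rw [mul_div_assoc]
      refine (h.trans_eq ?_).trans
        (CarlemanODE.first_block_constant_le hk hp.le hg hX0)
      simp only [zero_add, pow_one, Nat.sub_zero, f]
    refine ⟨hblock, fun hR y hy t ht => ?_⟩
    have hR0 : 0 ≤ 4 * X * f / δ := by positivity
    refine squeeze_zero (fun _ => norm_nonneg _)
      (fun k => hblock (k + 1) k.succ_pos (y k) (hy k) t ht) ?_
    have h1 := (tendsto_pow_atTop_nhds_zero_of_lt_one hR0 hR).comp (tendsto_add_atTop_nat 2)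
    simpa using h1.const_mul p
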